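/- A rooted planar map is a connected planar map (up to orientation-preserving homeomorphism) with a distinguished oriented edge, drawn in the plane so that the infinite face lies on the right of that edge. Let $\triangle_2=\{\Theta\}$, where $\Theta$ is the rooted triangle, and for $k\ge 1$ let $\triangle_{2(k+1)}$ be the set of rooted triangulations obtained from some $m\in\triangle_{2k}$ by choosing a finite face $f$ of $m$, adding a new vertex inside $f$ and joining it by three non-crossing edges inside $f$ to the three vertices of $f$. The elements of $\triangle_{2n}$ are the stack-triangulations with $2n$ faces. Their internal vertices are those that are not incident to the infinite face. For $n\ge 2$, let $m_n$ be a uniform random element of $\triangle_{2n}$, let $u(1)$ be the first vertex inserted in $m_n$ (it does not depend on the order of insertions used to construct $m_n$), and, given $m_n$, let $\mathbf u$ be a uniform random internal vertex of $m_n$. Then, as $n\to\infty$: (i) $\deg_{m_n}(u(1))$ converges in law to a random variable $X$ with $$\mathbb P(X=k+3)=\frac{k}{k+3}\binom{2k+2}{k}\frac{2^{k+3}}{3^{2k+3}}\qquad\text{for all } k\ge 0;$$ (ii) $\deg_{m_n}(\mathbf u)$ converges in law to a random variable $Y$ with $$\mathbb P(Y=k+3)=\frac{1}{k+3}\binom{2k+2}{k}\frac{2^{k+3}}{3^{2k+2}}\qquad\text{for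 all } k\ge 0.$$ -/

import Mathlib

open Equiv Filter Topology MeasureTheory

/-- A rooted map on an oriented surface, given by its darts (oriented edges). `next d` is the dart
that follows `d` in counterclockwise order around the origin of `d`, `rev d` is `d` with the
opposite orientation, and `root` is the distinguished oriented edge. Only the maps obtained from
a triangle in the plane by inserting vertices into faces are used below; these are connected and
planar. -/
structure RootedMap (D : Type) where
  next : Perm D
  rev : Perm D
  rev_rev : ∀ d, rev (rev d) = d
  rev_ne : ∀ d, rev d ≠ d
  root : D

namespace RootedMap

variable {D D' D'' : Type}

/-- Isomorphisms of rooted maps: orientation preserving and root preserving. -/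
structure Iso (M : RootedMap D) (N : RootedMap D') where
  toEquiv : D ≃ D'
  map_next : ∀ d, toEquiv (M.next d) = N.next (toEquiv d)
  map_rev : ∀ d, toEquiv (M.rev d) = N.rev (toEquiv d)
  map_root : toEquiv M.root = N.root

def Iso.refl (M : RootedMap D) : Iso M M := ⟨Equiv.refl D, fun _ => rfl, fun _ => rfl, rfl⟩

def Iso.symm {M : RootedMap D} {N : RootedMap D'} (e : Iso M N) : Iso N M where
  toEquiv := e.toEquiv.symm
  map_next d := by rw [Equiv.symm_apply_eq, e.map_next, Equiv.apply_symm_apply]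
  map_rev d := by rw [Equiv.symm_apply_eq, e.map_rev, Equiv.apply_symm_apply]
  map_root := by rw [Equiv.symm_apply_eq, e.map_root]

def Iso.trans {M : RootedMap D} {N : RootedMap D'} {P : RootedMap D''} (e : Iso M N)
    (e' : Iso N P) : Iso M P where
  toEquiv := e.toEquiv.trans e'.toEquiv
  map_next d := by simp [e.map_next, e'.map_next]
  map_rev d := by simp [e.map_rev, e'.map_rev]
  map_root := by simp [e.map_root, e'.map_root]

/-- Vertices: orbits of `next`. The vertex `⟦d⟧` is the origin of the dart `d`. -/
abbrev Vertex (M : RootedMap D) : Type := Quotient (Perm.SameCycle.setoid M.next)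

/-- The origin of a dart. -/
def origin (M : RootedMap D) (d : D) : M.Vertex := Quotient.mk _ d

/-- The degree of a vertex is the number of darts that leave it. -/
noncomputable def degree (M : RootedMap D) (v : M.Vertex) : ℕ := {d : D | M.origin d = v}.ncard

/-- The successor of a dart on the boundary of the face on its left. Faces are the orbits of this
permutation. -/
def face (M : RootedMap D) : Perm D := M.next⁻¹ * M.rev

/-- The dart `d` has the infinite face on its left. The infinite face is the face on the right of
the root, i.e. on the left of the reversed root. -/
def InInfiniteFace (M : RootedMap D) (d : D) : Prop := M.face.SameCycle (M.rev M.root) d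

/-- A vertex is internal if it is not incident to the infinite face. -/
def IsInternal (M : RootedMap D) (v : M.Vertex) : Prop :=
  ∀ d, M.origin d = v → ¬ M.InInfiniteFace d

/-- The rooted triangle with corners `E 0`, `E 1`, `E 2` in counterclockwise order: `(i, true)` is
the edge from `E i` to `E (i + 1)`, and `(i, false)` is the same edge from `E (i + 1)` to `E i`.
The root goes from `E 0` to `E 1`, and its left side is the finite face. -/
def triangle : RootedMap (Fin 3 × Bool) where
  next :=
    { toFun := fun p => if p.2 then (p.1 - 1, false) else (p.1 + 1, true)
      invFun := fun p => if p.2 then (p.1 - 1, false) else (p.1 + 1, true)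
      left_inv := by decide
      right_inv := by decide }
  rev :=
    { toFun := fun p => (p.1, !p.2)
      invFun := fun p => (p.1, !p.2)
      left_inv := by decide
      right_inv := by decide }
  rev_rev := by decide
  rev_ne := by decide
  root := (0, true)

/-- The six new darts of an insertion: `(i, false)` goes from the `i`-th corner of the face to the
new vertex, `(i, true)` goes from the new vertex to the `i`-th corner. This is the rotation around
the new vertex. -/
def spin : Perm (Fin 3 × Bool) where
  toFun p := if p.2 then (p.1 + 1, true) else p
  invFun p := if p.2 then (p.1 - 1, true) else p
  left_inv := by decide
  right_inv := by decide

/-- The reversal of the six new darts. -/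
def flip : Perm (Fin 3 × Bool) where
  toFun p := (p.1, !p.2)
  invFun p := (p.1, !p.2)
  left_inv := by decide
  right_inv := by decide

/-- Exchanges the dart `d` and the new dart `(i, false)`. -/
noncomputable def exch (d : D) (i : Fin 3) : Perm (D ⊕ Fin 3 × Bool) :=
  haveI : DecidableEq (D ⊕ Fin 3 × Bool) := Classical.decEq _
  swap (Sum.inl d) (Sum.inr (i, false))

/-- Insertion of a vertex in the triangular face on the left of the dart `f`. The boundary of this
face consists of `f`, `face f` and `face (face f)`, whose origins are the corners `0`, `1`, `2`.
Around each corner, the new dart to the new vertex is put just after the boundary dart, i.e. if `d`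
is the `i`-th boundary dart, then the new rotation sends `d` to `(i, false)` and `(i, false)` to
the former successor of `d`. -/
noncomputable def insertVertex (M : RootedMap D) (f : D) : RootedMap (D ⊕ Fin 3 × Bool) where
  next := Equiv.sumCongr M.next spin *
    (exch f 0 * exch (M.face f) 1 * exch (M.face (M.face f)) 2)
  rev := Equiv.sumCongr M.rev flip
  rev_rev := by
    rintro (d | p)
    · simp [M.rev_rev]
    · simp [flip]
  rev_ne := by
    rintro (d | p)
    · simp [M.rev_ne]
    · obtain ⟨i, b⟩ := p
      cases b <;> simp [flip]
  root := Sum.inl M.root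

/-- Stack-triangulations with `2 * k` faces, with arbitrary labels on the darts. -/
inductive IsStack : ℕ → {D : Type} → RootedMap D → Prop
  | base : IsStack 1 triangle
  | step {k : ℕ} {D : Type} {M : RootedMap D} (f : D) :
      IsStack k M → ¬ M.InInfiniteFace f → IsStack (k + 1) (M.insertVertex f)
  | iso {k : ℕ} {D D' : Type} {M : RootedMap D} {N : RootedMap D'} (e : Iso M N) :
      IsStack k M → IsStack k N

/-- `IsFirstInserted M v`: there is a construction of `M` from the rooted triangle, by successive
insertions of vertices in finite faces, in which `v` is the vertex that is inserted first. -/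
inductive IsFirstInserted : {D : Type} → (M : RootedMap D) → M.Vertex → Prop
  | base (f : Fin 3 × Bool) : ¬ triangle.InInfiniteFace f →
      IsFirstInserted (triangle.insertVertex f)
        ((triangle.insertVertex f).origin (Sum.inr (0, true)))
  | step {D : Type} {M : RootedMap D} (f d : D) : IsFirstInserted M (M.origin d) →
      ¬ M.InInfiniteFace f →
      IsFirstInserted (M.insertVertex f) ((M.insertVertex f).origin (Sum.inl d))
  | iso {D D' : Type} {M : RootedMap D} {N : RootedMap D'} (e : Iso M N) (d : D) :
      IsFirstInserted M (M.origin d) → IsFirstInserted N (N.origin (e.toEquiv d))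

/-- Rooted maps with `2 * n` triangular faces have `3 * n` edges, hence `6 * n` darts. Two labelled
stack-triangulations are identified if there is an isomorphism of rooted maps between them. -/
instance stackSetoid (n : ℕ) : Setoid {M : RootedMap (Fin (6 * n)) // IsStack n M} where
  r M N := Nonempty (Iso M.1 N.1)
  iseqv := ⟨fun M => ⟨Iso.refl M.1⟩, fun ⟨e⟩ => ⟨e.symm⟩, fun ⟨e⟩ ⟨e'⟩ => ⟨e.trans e'⟩⟩

end RootedMap

/-- The set of stack-triangulations with `2 * n` faces (rooted maps up to isomorphism). -/
def StackTriangulation (n : ℕ) : Type := Quotient (RootedMap.stackSetoid n)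

namespace RootedMap

variable {D D' : Type}

/-! ### The sets over which uniform choices are made are finite and not empty -/

theorem Iso.sameCycle {p : Perm D} {q : Perm D'} (e : D ≃ D') (h : ∀ d, e (p d) = q (e d))
    (a b : D) : q.SameCycle (e a) (e b) ↔ p.SameCycle a b := by
  have hq : q = e.permCongr p := by
    ext x
    simp [Equiv.permCongr_apply, h]
  have hz : ∀ z : ℤ, (q ^ z) (e a) = e ((p ^ z) a) := by
    intro z
    have : q ^ z = e.permCongr (p ^ z) := by
      rw [hq]
      exact (map_zpow e.permCongrHom p z).symm
    rw [this]
    simp [Equiv.permCongr_apply]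
  simp [Perm.SameCycle, hz]

theorem Iso.map_face {M : RootedMap D} {N : RootedMap D'} (e : Iso M N) (d : D) :
    e.toEquiv (M.face d) = N.face (e.toEquiv d) := by
  simp only [face, Perm.mul_apply]
  rw [Perm.eq_inv_iff_eq, ← e.map_next, ← e.map_rev]
  simp

theorem Iso.infinite {M : RootedMap D} {N : RootedMap D'} (e : Iso M N) (d : D) :
    N.InInfiniteFace (e.toEquiv d) ↔ M.InInfiniteFace d := by
  unfold InInfiniteFace
  rw [← e.map_root, ← e.map_rev]
  exact Iso.sameCycle e.toEquiv e.map_face _ _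

theorem origin_eq {M : RootedMap D} {a b : D} :
    M.origin a = M.origin b ↔ M.next.SameCycle a b := by
  unfold origin
  rw [Quotient.eq]
  rfl

theorem exch_of_ne {d : D} {i : Fin 3} {x : D ⊕ Fin 3 × Bool} (h : x ≠ Sum.inl d)
    (h' : x ≠ Sum.inr (i, false)) : exch d i x = x := by
  unfold exch
  exact @swap_apply_of_ne_of_ne _ (Classical.decEq _) _ _ _ h h'

theorem insert_next_inl (M : RootedMap D) {f d : D} (h0 : d ≠ f) (h1 : d ≠ M.face f)
    (h2 : d ≠ M.face (M.face f)) :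
    (M.insertVertex f).next (Sum.inl d) = Sum.inl (M.next d) := by
  simp only [insertVertex, Perm.mul_apply]
  rw [exch_of_ne (x := Sum.inl d) (by simpa using h2) (by simp),
    exch_of_ne (x := Sum.inl d) (by simpa using h1) (by simp),
    exch_of_ne (x := Sum.inl d) (by simpa using h0) (by simp)]
  rfl

theorem insert_next_new (M : RootedMap D) (f : D) (i : Fin 3) :
    (M.insertVertex f).next (Sum.inr (i, true)) = Sum.inr (i + 1, true) := by
  simp only [insertVertex, Perm.mul_apply]
  rw [exch_of_ne (x := Sum.inr (i, true)) (by simp) (by simp),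
    exch_of_ne (x := Sum.inr (i, true)) (by simp) (by simp),
    exch_of_ne (x := Sum.inr (i, true)) (by simp) (by simp)]
  rfl

theorem insert_face_inl (M : RootedMap D) {f : D} (hf : ¬ M.InInfiniteFace f) {d : D}
    (hd : M.InInfiniteFace d) : (M.insertVertex f).face (Sum.inl d) = Sum.inl (M.face d) := by
  have hd' : M.InInfiniteFace (M.face d) := Perm.sameCycle_apply_right.2 hd
  have key : ∀ g, ¬ M.InInfiniteFace g → M.face d ≠ g := fun g hg h => hg (h ▸ hd')
  have step : ∀ g, ¬ M.InInfiniteFace g → ¬ M.InInfiniteFace (M.face g) :=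
    fun g hg h => hg (Perm.sameCycle_apply_right.1 h)
  have h := M.insert_next_inl (key f hf) (key _ (step _ hf)) (key _ (step _ (step _ hf)))
  rw [face, Perm.mul_apply, Perm.inv_eq_iff_eq, h]
  simp [insertVertex, face]

/-- An insertion in a finite face does not change the infinite face. -/
theorem insert_infinite (M : RootedMap D) {f : D} (hf : ¬ M.InInfiniteFace f)
    {x : D ⊕ Fin 3 × Bool} (hx : (M.insertVertex f).InInfiniteFace x) :
    ∃ d, x = Sum.inl d ∧ M.InInfiniteFace d := by
  obtain ⟨z, rfl⟩ := hx
  have hr : (M.insertVertex f).rev (M.insertVertex f).root = Sum.inl (M.rev M.root) := rfl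
  rw [hr]
  induction z using Int.induction_on with
  | zero => exact ⟨_, rfl, Perm.SameCycle.refl _ _⟩
  | succ n ih =>
    obtain ⟨d, h, hd⟩ := ih
    refine ⟨M.face d, ?_, Perm.sameCycle_apply_right.2 hd⟩
    rw [add_comm, zpow_add, zpow_one, Perm.mul_apply, h, M.insert_face_inl hf hd]
  | pred n ih =>
    obtain ⟨d, h, hd⟩ := ih
    have hd' : M.InInfiniteFace (M.face⁻¹ d) := by
      refine Perm.sameCycle_apply_right.1 ?_
      simpa [InInfiniteFace] using hd
    refine ⟨M.face⁻¹ d, ?_, hd'⟩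
    rw [sub_eq_add_neg, add_comm, zpow_add, zpow_neg_one, Perm.mul_apply, h, Perm.inv_eq_iff_eq,
      M.insert_face_inl hf hd']
    simp

theorem insert_new_internal (M : RootedMap D) {f : D} (hf : ¬ M.InInfiniteFace f) :
    (M.insertVertex f).IsInternal ((M.insertVertex f).origin (Sum.inr (0, true))) := by
  intro x hx hinf
  obtain ⟨d, rfl, -⟩ := M.insert_infinite hf hinf
  have hc := (origin_eq.1 hx).symm
  obtain ⟨z, hz⟩ := hc
  have : ∀ z : ℤ, ∃ i, ((M.insertVertex f).next ^ z) (Sum.inr (0, true)) = Sum.inr (i, true) := by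
    intro z
    induction z using Int.induction_on with
    | zero => exact ⟨0, rfl⟩
    | succ n ih =>
      obtain ⟨i, hi⟩ := ih
      exact ⟨i + 1, by rw [add_comm, zpow_add, zpow_one, Perm.mul_apply, hi, insert_next_new]⟩
    | pred n ih =>
      obtain ⟨i, hi⟩ := ih
      refine ⟨i - 1, ?_⟩
      rw [sub_eq_add_neg, add_comm, zpow_add, zpow_neg_one, Perm.mul_apply, hi,
        Perm.inv_eq_iff_eq, insert_next_new]
      simp
  obtain ⟨i, hi⟩ := this z
  rw [hz] at hi
  cases hi

theorem Iso.internal {M : RootedMap D} {N : RootedMap D'} (e : Iso M N) {d : D}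
    (h : M.IsInternal (M.origin d)) : N.IsInternal (N.origin (e.toEquiv d)) := by
  intro x hx hinf
  obtain ⟨y, rfl⟩ := e.toEquiv.surjective x
  rw [e.infinite] at hinf
  refine h y ?_ hinf
  rw [origin_eq] at hx ⊢
  exact (Iso.sameCycle e.toEquiv e.map_next _ _).1 hx

theorem triangle_root_finite : ¬ triangle.InInfiniteFace (0, true) := by
  unfold InInfiniteFace
  rintro ⟨z, hz⟩
  have : ∀ z : ℤ, ((triangle.face ^ z) (triangle.rev triangle.root)).2 = false := by
    have h1 : ∀ p : Fin 3 × Bool, (triangle.face p).2 = p.2 := by decide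
    intro z
    induction z using Int.induction_on with
    | zero => rfl
    | succ n ih => rw [add_comm, zpow_add, zpow_one, Perm.mul_apply, h1, ih]
    | pred n ih =>
      rw [sub_eq_add_neg, add_comm, zpow_add, zpow_neg_one, Perm.mul_apply, ← h1]
      simpa using ih
  have h := this z
  rw [hz] at h
  cases h

theorem IsStack.exists_finite {k : ℕ} {D : Type} {M : RootedMap D} (h : IsStack k M) :
    ∃ f, ¬ M.InInfiniteFace f := by
  induction h with
  | base => exact ⟨_, triangle_root_finite⟩
  | step f _ hf _ =>
    refine ⟨Sum.inr (0, true), fun h => ?_⟩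
    obtain ⟨d, h, -⟩ := insert_infinite _ hf h
    cases h
  | iso e _ ih =>
    obtain ⟨f, hf⟩ := ih
    exact ⟨e.toEquiv f, fun h => hf ((e.infinite f).1 h)⟩

theorem IsStack.exists_internal {k : ℕ} {D : Type} {M : RootedMap D} (h : IsStack k M) :
    2 ≤ k → ∃ d, M.IsInternal (M.origin d) := by
  induction h with
  | base => intro h; omega
  | step f _ hf _ => exact fun _ => ⟨_, insert_new_internal _ hf⟩
  | iso e _ ih =>
    intro hk
    obtain ⟨d, hd⟩ := ih hk
    exact ⟨_, e.internal hd⟩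

theorem IsStack.one_le {k : ℕ} {D : Type} {M : RootedMap D} (h : IsStack k M) : 1 ≤ k := by
  induction h with
  | base => rfl
  | step _ _ _ _ => omega
  | iso _ _ ih => exact ih

theorem IsStack.eq_triangle {k : ℕ} {D : Type} {M : RootedMap D} (h : IsStack k M) :
    k = 1 → Nonempty (Iso triangle M) := by
  induction h with
  | base => exact fun _ => ⟨Iso.refl _⟩
  | step f h _ _ => intro hk; have := h.one_le; omega
  | iso e _ ih => exact fun hk => (ih hk).map fun e' => e'.trans e

/-- An isomorphism extends to the maps obtained by insertion in corresponding faces. -/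
theorem Iso.insert {M : RootedMap D} {N : RootedMap D'} (e : Iso M N) (f : D) :
    ∃ e' : Iso (M.insertVertex f) (N.insertVertex (e.toEquiv f)),
      ∀ p, e'.toEquiv (Sum.inr p) = Sum.inr p := by
  have hex : ∀ (d : D) (i : Fin 3) (x : D ⊕ Fin 3 × Bool),
      Equiv.sumCongr e.toEquiv (Equiv.refl _) (exch d i x) =
        exch (e.toEquiv d) i (Equiv.sumCongr e.toEquiv (Equiv.refl _) x) := by
    intro d i x
    classical
    simp only [exch, swap_apply_def]
    rcases x with x | x
    · by_cases hx : x = d <;> simp [hx]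
    · by_cases hx : x = (i, false) <;> simp [hx]
  have hs : ∀ x : D ⊕ Fin 3 × Bool,
      Equiv.sumCongr e.toEquiv (Equiv.refl _) (Equiv.sumCongr M.next spin x) =
        Equiv.sumCongr N.next spin (Equiv.sumCongr e.toEquiv (Equiv.refl _) x) := by
    rintro (x | x)
    · simp [e.map_next]
    · simp
  refine ⟨⟨Equiv.sumCongr e.toEquiv (Equiv.refl _), ?_, ?_, ?_⟩, fun p => rfl⟩
  · intro x
    simp only [insertVertex, Perm.mul_apply, ← e.map_face]
    rw [hs, hex, hex, hex]
  · rintro (x | x)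
    · simp [insertVertex, e.map_rev]
    · simp [insertVertex]
  · simp [insertVertex, e.map_root]

theorem IsStack.exists_first {k : ℕ} {D : Type} {M : RootedMap D} (h : IsStack k M) :
    2 ≤ k → ∃ d, M.IsFirstInserted (M.origin d) := by
  induction h with
  | base => intro h; omega
  | @step k D M f h hf ih =>
    intro _
    by_cases hk : k = 1
    · obtain ⟨e⟩ := h.eq_triangle hk
      obtain ⟨f, rfl⟩ := e.toEquiv.surjective f
      rw [e.infinite] at hf
      obtain ⟨e', -⟩ := e.insert f
      exact ⟨_, IsFirstInserted.iso e' _ (IsFirstInserted.base f hf)⟩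
    · obtain ⟨d, hd⟩ := ih (by have := h.one_le; omega)
      exact ⟨_, IsFirstInserted.step f d hd hf⟩
  | iso e _ ih =>
    intro hk
    obtain ⟨d, hd⟩ := ih hk
    exact ⟨_, IsFirstInserted.iso e d hd⟩

/-- A map with other labels on the darts. -/
def relabel (M : RootedMap D) (e : D ≃ D') : RootedMap D' where
  next := e.permCongr M.next
  rev := e.permCongr M.rev
  rev_rev d := by simp [Equiv.permCongr_apply, M.rev_rev]
  rev_ne d := by
    rw [Equiv.permCongr_apply, ne_eq, ← Equiv.eq_symm_apply]
    exact M.rev_ne _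
  root := e M.root

def relabelIso (M : RootedMap D) (e : D ≃ D') : Iso M (M.relabel e) where
  toEquiv := e
  map_next d := by simp [relabel, Equiv.permCongr_apply]
  map_rev d := by simp [relabel, Equiv.permCongr_apply]
  map_root := rfl

theorem exists_isStack (n : ℕ) : ∃ M : RootedMap (Fin (6 * (n + 1))), IsStack (n + 1) M := by
  induction n with
  | zero =>
    have e : Fin 3 × Bool ≃ Fin (6 * (0 + 1)) := Fintype.equivFinOfCardEq (by simp)
    exact ⟨_, IsStack.iso (triangle.relabelIso e) IsStack.base⟩
  | succ n ih =>
    obtain ⟨M, hM⟩ := ih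
    obtain ⟨f, hf⟩ := hM.exists_finite
    have e : Fin (6 * (n + 1)) ⊕ Fin 3 × Bool ≃ Fin (6 * (n + 1 + 1)) :=
      Fintype.equivFinOfCardEq (by simp; ring)
    exact ⟨_, IsStack.iso ((M.insertVertex f).relabelIso e) (IsStack.step f hM hf)⟩

instance finite [Finite D] : Finite (RootedMap D) := by
  have : Function.Injective
      (fun M : RootedMap D => ((M.next, M.rev, M.root) : Perm D × Perm D × D)) := by
    intro M N h
    cases M
    cases N
    simp_all
  exact Finite.of_injective _ this

end RootedMap

namespace StackTriangulation

/-- A labelled representative of a stack-triangulation. -/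
noncomputable def rep {n : ℕ} (t : StackTriangulation n) : RootedMap (Fin (6 * n)) :=
  (Quotient.out t).1

theorem rep_isStack {n : ℕ} (t : StackTriangulation n) : t.rep.IsStack n := (Quotient.out t).2

instance (n : ℕ) : Finite (StackTriangulation n) := Quotient.finite _

noncomputable instance (n : ℕ) : Fintype (StackTriangulation n) := Fintype.ofFinite _

instance (n : ℕ) : Nonempty (StackTriangulation (n + 1)) := by
  obtain ⟨M, hM⟩ := RootedMap.exists_isStack n
  exact ⟨Quotient.mk _ ⟨M, hM⟩⟩

/-- The set of internal vertices. -/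
def InternalVertex {n : ℕ} (t : StackTriangulation n) : Type :=
  {v : t.rep.Vertex // t.rep.IsInternal v}

instance {n : ℕ} (t : StackTriangulation n) : Finite t.InternalVertex := by
  unfold InternalVertex
  infer_instance

noncomputable instance {n : ℕ} (t : StackTriangulation n) : Fintype t.InternalVertex :=
  Fintype.ofFinite _

instance {n : ℕ} (t : StackTriangulation (n + 2)) : Nonempty t.InternalVertex := by
  obtain ⟨d, hd⟩ := t.rep_isStack.exists_internal (by omega)
  exact ⟨⟨_, hd⟩⟩

/-- There is a first inserted vertex as soon as there is more than one finite face. -/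
theorem exists_isFirstInserted {n : ℕ} (t : StackTriangulation (n + 2)) :
    ∃ v : t.rep.Vertex, t.rep.IsFirstInserted v := by
  obtain ⟨d, hd⟩ := t.rep_isStack.exists_first (by omega)
  exact ⟨_, hd⟩

/-- The law of the degree of the vertex `u t` of `t`, for a uniform stack-triangulation `t` with
`2 * (n + 2)` faces. -/
noncomputable def degreeLaw (n : ℕ) (u : ∀ t : StackTriangulation (n + 2), t.rep.Vertex) :
    PMF ℕ :=
  (PMF.uniformOfFintype (StackTriangulation (n + 2))).map fun t => t.rep.degree (u t)

/-- The law of the degree of a uniform internal vertex of a uniform stack-triangulation with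
`2 * (n + 2)` faces. -/
noncomputable def internalDegreeLaw (n : ℕ) : PMF ℕ :=
  (PMF.uniformOfFintype (StackTriangulation (n + 2))).bind fun t =>
    (PMF.uniformOfFintype t.InternalVertex).map fun v => t.rep.degree v.1

end StackTriangulation

/-- A probability mass function on the integers as an element of the space of probability measures,
which carries the topology of convergence in law. -/
noncomputable def PMF.law (p : PMF ℕ) : ProbabilityMeasure ℕ := ⟨p.toMeasure, inferInstance⟩

/-!
Stack-triangulations with `2 * (n + 1)` faces correspond to ternary trees with `n` nodes: the nodes
are the inserted vertices and the leaves are the finite faces. An insertion increases the degree of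
a given vertex when it takes place in a face at that vertex; such a face is then replaced by two
faces at the vertex and one away from it. Hence the insertions that increase the degree form a
binary forest, and the trees that hang off this forest are arbitrary ternary trees. Summing over the
possible subtrees in the case of a random internal vertex, one finds that the probabilities of the
degrees are ratios of binomial coefficients, whose limits are elementary. The limits sum to `1`, as
the generating functions of the binary forests show, so no mass escapes and the laws converge.
-/

namespace StackCode

/-- Labels of darts: `(none, i, b)` are the darts of the outer triangle and `(some p, i, b)` those
created by the insertion of a vertex in the face `p`. Faces are nodes of the infinite ternary tree,
written as lists in which the last step comes first. -/
abbrev DartLabel : Type := Option (List (Fin 3)) × Fin 3 × Bool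

/-- Labels of vertices: the outer corners, and the vertices inserted in the faces `p`. -/
abbrev VertexLabel : Type := Fin 3 ⊕ List (Fin 3)

/-- The boundary darts of the face `p`. The insertion of a vertex in `p` creates the faces
`0 :: p`, `1 :: p` and `2 :: p`. -/
@[simp] def side : List (Fin 3) → Fin 3 → DartLabel
  | [], i => (none, i, true)
  | c :: p, 0 => side p c
  | c :: p, 1 => (some p, c + 1, false)
  | c :: p, 2 => (some p, c, true)

/-- The corners of the face `p`. -/
@[simp] def corner : List (Fin 3) → Fin 3 → VertexLabel
  | [], i => Sum.inl i
  | c :: p, 0 => corner p c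
  | c :: p, 1 => corner p (c + 1)
  | _ :: p, 2 => Sum.inr p

/-- The origin of a dart label. -/
@[simp] def source : DartLabel → VertexLabel
  | (none, i, true) => Sum.inl i
  | (none, i, false) => Sum.inl (i + 1)
  | (some p, _, true) => Sum.inr p
  | (some p, i, false) => corner p i

/-- The label of the reversed dart. -/
@[simp] def reverse (u : DartLabel) : DartLabel := (u.1, u.2.1, !u.2.2)

/-- A set of nodes of the infinite ternary tree that contains the parents of its elements. -/
def IsTree (S : Finset (List (Fin 3))) : Prop := ∀ c p, c :: p ∈ S → p ∈ S

/-- The parent of `p`, if any, belongs to `S`. -/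
@[simp] def IsPosition (S : Finset (List (Fin 3))) : List (Fin 3) → Prop
  | [] => True
  | _ :: p => p ∈ S

/-- The leaves of a tree are the finite faces of the map. -/
def IsLeaf (S : Finset (List (Fin 3))) (p : List (Fin 3)) : Prop := p ∉ S ∧ IsPosition S p

/-- The labels that occur in a map with inserted vertices `S`. -/
def InDarts (S : Finset (List (Fin 3))) (u : DartLabel) : Prop := ∀ p ∈ u.1, p ∈ S

variable {S : Finset (List (Fin 3))}

@[simp] theorem inDarts_none (x : Fin 3 × Bool) : InDarts S (none, x) := by simp [InDarts]

@[simp] theorem inDarts_some {p : List (Fin 3)} {x : Fin 3 × Bool} :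
    InDarts S (some p, x) ↔ p ∈ S := by simp [InDarts]

theorem IsTree.isPosition (hS : IsTree S) : ∀ {p : List (Fin 3)}, p ∈ S → IsPosition S p
  | [], _ => trivial
  | c :: p, hp => hS c p hp

theorem IsTree.nil_mem (hS : IsTree S) : ∀ {p : List (Fin 3)}, p ∈ S → [] ∈ S
  | [], hp => hp
  | c :: p, hp => hS.nil_mem (hS c p hp)

theorem isLeaf_empty {p : List (Fin 3)} : IsLeaf ∅ p ↔ p = [] := by
  cases p <;> simp [IsLeaf]

theorem IsTree.insert (hS : IsTree S) {p : List (Fin 3)} (hp : IsPosition S p) :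
    IsTree (insert p S) := by
  intro c q hq
  rcases Finset.mem_insert.1 hq with rfl | hq
  · exact Finset.mem_insert_of_mem hp
  · exact Finset.mem_insert_of_mem (hS c q hq)

theorem IsLeaf.of_insert {p q : List (Fin 3)} (hq : IsLeaf (insert p S) q) :
    IsLeaf S q ∧ q ≠ p ∨ ∃ c, q = c :: p := by
  obtain ⟨hqS, hqp⟩ := hq
  simp only [Finset.mem_insert, not_or] at hqS
  rcases q with _ | ⟨c, q⟩
  · exact Or.inl ⟨⟨hqS.2, trivial⟩, hqS.1⟩
  · rcases Finset.mem_insert.1 hqp with rfl | hq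
    · exact Or.inr ⟨c, rfl⟩
    · exact Or.inl ⟨⟨hqS.2, hq⟩, hqS.1⟩

theorem inDarts_insert_iff {p : List (Fin 3)} {u : DartLabel} :
    InDarts (insert p S) u ↔ InDarts S u ∨ u.1 = some p := by
  obtain ⟨_ | q, x⟩ := u
  · simp
  · simp [or_comm]

theorem IsTree.erase (hS : IsTree S) {p : List (Fin 3)} (hp : ∀ q ∈ S, q.length ≤ p.length) :
    IsTree (S.erase p) := by
  intro c q hq
  refine Finset.mem_erase.2 ⟨?_, hS c q (Finset.mem_of_mem_erase hq)⟩
  rintro rfl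
  simpa using hp _ (Finset.mem_of_mem_erase hq)

theorem IsTree.isLeaf_erase (hS : IsTree S) {p : List (Fin 3)} (hp : p ∈ S) :
    IsLeaf (S.erase p) p := by
  refine ⟨Finset.notMem_erase p S, ?_⟩
  rcases p with _ | ⟨c, p⟩
  · trivial
  · exact Finset.mem_erase.2 ⟨(List.cons_ne_self c p).symm, hS c p hp⟩

/-! ### Boundary darts of the faces -/

theorem side_inDarts (hS : IsTree S) : ∀ {p : List (Fin 3)}, IsPosition S p → ∀ i,
    InDarts S (side p i)
  | [], _, _ => inDarts_none _
  | c :: _, hp, 0 => side_inDarts hS (hS.isPosition hp) c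
  | _ :: _, hp, 1 => inDarts_some.2 hp
  | _ :: _, hp, 2 => inDarts_some.2 hp

theorem source_side : ∀ (p : List (Fin 3)) (i : Fin 3), source (side p i) = corner p i
  | [], _ => rfl
  | c :: p, 0 => source_side p c
  | _ :: _, 1 => rfl
  | _ :: _, 2 => rfl

theorem source_reverse_side : ∀ (p : List (Fin 3)) (i : Fin 3),
    source (reverse (side p i)) = corner p (i + 1)
  | [], _ => rfl
  | c :: p, 0 => source_reverse_side p c
  | _ :: _, 1 => rfl
  | _ :: _, 2 => rfl

theorem side_ne_outer : ∀ (p : List (Fin 3)) (i j : Fin 3), side p i ≠ (none, j, false)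
  | [], _, _ => by simp
  | c :: p, 0, j => side_ne_outer p c j
  | _ :: _, 1, _ => by simp
  | _ :: _, 2, _ => by simp

/-- The position of a boundary dart in the face that inherits it when a vertex is inserted. -/
def descend (x : List (Fin 3) × Fin 3) : List (Fin 3) × Fin 3 := (x.2 :: x.1, 0)

/-- The first face on the left of a dart, with the position of the dart on its boundary. The darts
`(none, i, false)`, which have the infinite face on their left, get a junk value. -/
def birth : DartLabel → List (Fin 3) × Fin 3
  | (none, i, _) => ([], i)
  | (some p, i, false) => ((i - 1) :: p, 1)
  | (some p, i, true) => (i :: p, 2)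

theorem side_birth : ∀ {u : DartLabel}, (∀ i, u ≠ (none, i, false)) →
    side (birth u).1 (birth u).2 = u
  | (none, i, false), h => absurd rfl (h i)
  | (none, _, true), _ => rfl
  | (some _, _, false), _ => by simp [birth]
  | (some _, _, true), _ => rfl

theorem InDarts.isPosition_birth : ∀ {u : DartLabel}, InDarts S u → IsPosition S (birth u).1
  | (none, _, _), _ => trivial
  | (some _, _, false), hu => inDarts_some.1 hu
  | (some _, _, true), hu => inDarts_some.1 hu

theorem exists_iterate_descend_birth : ∀ (p : List (Fin 3)) (i : Fin 3),
    ∃ m, descend^[m] (birth (side p i)) = (p, i)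
  | [], _ => ⟨0, rfl⟩
  | c :: p, 0 => by
    obtain ⟨m, hm⟩ := exists_iterate_descend_birth p c
    exact ⟨m + 1, by rw [Function.iterate_succ_apply', side, hm, descend]⟩
  | _ :: _, 1 => ⟨0, by simp [birth]⟩
  | _ :: _, 2 => ⟨0, rfl⟩

theorem mem_of_isPosition_iterate_descend (hS : IsTree S) (m : ℕ) (x : List (Fin 3) × Fin 3)
    (h : IsPosition S (descend^[m + 1] x).1) : x.1 ∈ S := by
  induction m with
  | zero => exact h
  | succ m ih =>
    rw [Function.iterate_succ_apply'] at h
    exact ih (hS.isPosition h)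

/-- The faces that contain a given dart are nested, so only one of them is a leaf. -/
theorem IsLeaf.side_inj (hS : IsTree S) {p q : List (Fin 3)} (hp : IsLeaf S p) (hq : IsLeaf S q)
    {i j : Fin 3} (h : side p i = side q j) : p = q ∧ i = j := by
  obtain ⟨m, hm⟩ := exists_iterate_descend_birth p i
  obtain ⟨n, hn⟩ := exists_iterate_descend_birth q j
  rw [h] at hm
  wlog hmn : m ≤ n generalizing p q i j m n
  · obtain ⟨rfl, rfl⟩ := this hq hp h.symm n (h ▸ hn) m (h ▸ hm) (by omega)
    exact ⟨rfl, rfl⟩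
  obtain ⟨k, rfl⟩ := Nat.exists_eq_add_of_le' hmn
  rw [Function.iterate_add_apply, hm] at hn
  cases k with
  | zero => exact Prod.mk.inj hn
  | succ k =>
    exact absurd (mem_of_isPosition_iterate_descend hS k (p, i) (by rw [hn]; exact hq.2)) hp.1

theorem exists_isLeaf_side_eq {p : List (Fin 3)} (hp : IsPosition S p) (i : Fin 3) :
    ∃ q j, IsLeaf S q ∧ side p i = side q j := by
  by_cases hpS : p ∈ S
  · have := Finset.le_sup (f := List.length) hpS
    exact exists_isLeaf_side_eq (p := i :: p) hpS 0
  · exact ⟨p, i, ⟨hpS, hp⟩, rfl⟩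
termination_by S.sup List.length + 1 - p.length
decreasing_by simp only [List.length_cons]; omega

theorem InDarts.cover {u : DartLabel} (hu : InDarts S u) :
    (∃ i, u = (none, i, false)) ∨ ∃ p i, IsLeaf S p ∧ u = side p i := by
  by_cases h : ∃ i, u = (none, i, false)
  · exact Or.inl h
  · obtain ⟨q, j, hq, hj⟩ := exists_isLeaf_side_eq hu.isPosition_birth (birth u).2
    exact Or.inr ⟨q, j, hq, (side_birth (not_exists.1 h)).symm.trans hj⟩

/-! ### Corners of the faces -/

theorem length_lt_of_corner_eq_inr {q : List (Fin 3)} : ∀ {p : List (Fin 3)} {i : Fin 3},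
    corner p i = Sum.inr q → q.length < p.length
  | [], _, h => by simp at h
  | _ :: p, 0, h => (length_lt_of_corner_eq_inr (p := p) h).trans (Nat.lt_succ_self _)
  | _ :: p, 1, h => (length_lt_of_corner_eq_inr (p := p) h).trans (Nat.lt_succ_self _)
  | _ :: _, 2, h => Sum.inr.inj h ▸ Nat.lt_succ_self _

theorem mem_of_corner_eq_inr (hS : IsTree S) {q : List (Fin 3)} : ∀ {p : List (Fin 3)} {i : Fin 3},
    IsPosition S p → corner p i = Sum.inr q → q ∈ S
  | [], _, _, h => by simp at h
  | _ :: _, 0, hp, h => mem_of_corner_eq_inr hS (hS.isPosition hp) h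
  | _ :: _, 1, hp, h => mem_of_corner_eq_inr hS (hS.isPosition hp) h
  | _ :: _, 2, hp, h => Sum.inr.inj h ▸ hp

theorem mem_of_source_eq_inr (hS : IsTree S) {q : List (Fin 3)} : ∀ {u : DartLabel},
    InDarts S u → source u = Sum.inr q → q ∈ S
  | (none, _, false), _, h => by simp at h
  | (none, _, true), _, h => by simp at h
  | (some _, _, false), hu, h => mem_of_corner_eq_inr hS (hS.isPosition (inDarts_some.1 hu)) h
  | (some _, _, true), hu, h => Sum.inr.inj h ▸ inDarts_some.1 hu

theorem corner_ne_inr_self (p : List (Fin 3)) (i : Fin 3) : corner p i ≠ Sum.inr p :=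
  fun h => lt_irrefl _ (length_lt_of_corner_eq_inr h)

theorem mem_range_corner_cons {c : Fin 3} {p : List (Fin 3)} {v : VertexLabel} :
    v ∈ Set.range (corner (c :: p)) ↔ v = corner p c ∨ v = corner p (c + 1) ∨ v = Sum.inr p := by
  rw [Set.mem_range, Fin.exists_fin_succ]
  simp [Fin.exists_fin_two, eq_comm]

theorem corner_injective : ∀ p : List (Fin 3), Function.Injective (corner p)
  | [] => Sum.inl_injective
  | c :: p => by
    have hc : corner p c ≠ corner p (c + 1) := (corner_injective p).ne (by simp)
    have h₀ := corner_ne_inr_self p c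
    have h₁ := corner_ne_inr_self p (c + 1)
    intro i j
    fin_cases i <;> fin_cases j <;> simp [hc, h₀, h₁, hc.symm, h₀.symm, h₁.symm]

theorem corner_mem_range_cons {c x : Fin 3} {p : List (Fin 3)} :
    corner p x ∈ Set.range (corner (c :: p)) ↔ x ≠ c + 2 := by
  rw [mem_range_corner_cons, (corner_injective p).eq_iff, (corner_injective p).eq_iff]
  simp only [corner_ne_inr_self, or_false]
  revert c x
  decide

theorem eq_or_length_lt_of_mem_range_corner {c : Fin 3} {p q : List (Fin 3)}
    (h : Sum.inr q ∈ Set.range (corner (c :: p))) : q = p ∨ q.length < p.length := by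
  rcases mem_range_corner_cons.1 h with h | h | h
  · exact Or.inr (length_lt_of_corner_eq_inr h.symm)
  · exact Or.inr (length_lt_of_corner_eq_inr h.symm)
  · exact Or.inl (Sum.inr.inj h)

theorem inr_mem_range_corner_cons (c : Fin 3) (p : List (Fin 3)) :
    Sum.inr p ∈ Set.range (corner (c :: p)) := ⟨2, rfl⟩

/-- A face is determined by its corners: the most recent one gives the parent, and the corner of the
parent that is missing gives the direction. -/
theorem eq_of_range_corner_eq : ∀ {p q : List (Fin 3)},
    Set.range (corner p) = Set.range (corner q) → p = q
  | [], [], _ => rfl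
  | [], c :: q, h => by simpa [← h] using inr_mem_range_corner_cons c q
  | c :: p, [], h => by simpa [h] using inr_mem_range_corner_cons c p
  | c :: p, c' :: q, h => by
    have hpq := eq_or_length_lt_of_mem_range_corner (h ▸ inr_mem_range_corner_cons c p)
    have hqp := eq_or_length_lt_of_mem_range_corner (h ▸ inr_mem_range_corner_cons c' q)
    obtain rfl : p = q := by
      rcases hpq with hpq | hpq
      · exact hpq
      · exact (hqp.resolve_right hpq.asymm).symm
    have hc : c + 2 = c' + 2 := by
      by_contra hne
      exact corner_mem_range_cons.1 (h ▸ corner_mem_range_cons.2 hne) rfl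
    rw [add_right_cancel hc]

theorem eq_of_range_corner_subset {p q : List (Fin 3)}
    (h : Set.range (corner p) ⊆ Set.range (corner q)) : p = q :=
  eq_of_range_corner_eq <| Set.eq_of_subset_of_ncard_le h <| by
    rw [← Set.image_univ, ← Set.image_univ, Set.ncard_image_of_injective _ (corner_injective p),
      Set.ncard_image_of_injective _ (corner_injective q)]

theorem corner_append_singleton (c : Fin 3) : ∀ (p : List (Fin 3)) (i : Fin 3),
    corner (p ++ [c]) i = Sum.elim (corner [c]) (fun q => Sum.inr (q ++ [c])) (corner p i)
  | [], _ => rfl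
  | d :: p, 0 => corner_append_singleton c p d
  | d :: p, 1 => corner_append_singleton c p (d + 1)
  | _ :: _, 2 => rfl

theorem source_reverse_of_source_eq_inr {q : List (Fin 3)} : ∀ {u : DartLabel},
    source u = Sum.inr q → source (reverse u) ∈ Set.range (corner q) ∨
      ∃ r, source (reverse u) = Sum.inr r ∧ q.length < r.length
  | (none, _, false), h => by simp at h
  | (none, _, true), h => by simp at h
  | (some r, _, false), h => Or.inr ⟨r, rfl, length_lt_of_corner_eq_inr h⟩
  | (some _, i, true), h => Or.inl ⟨i, by rw [← Sum.inr.inj h]; rfl⟩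

/-- The number of insertions in `S` that increase the degree of the vertex `v`. -/
def cornerCount (S : Finset (List (Fin 3))) (v : VertexLabel) : ℕ :=
  ∑ p ∈ S, (Finset.univ.filter fun i => corner p i = v).card

theorem ncard_source_eq_inr {q : List (Fin 3)} (hq : q ∈ S) :
    {u | InDarts S u ∧ source u = Sum.inr q}.ncard = 3 + cornerCount S (Sum.inr q) := by
  let fromCenter (i : Fin 3) : DartLabel := (some q, i, true)
  let fromCorner (x : Σ _ : List (Fin 3), Fin 3) : DartLabel := (some x.1, x.2, false)
  have h : {u | InDarts S u ∧ source u = Sum.inr q} =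
      (Finset.univ.image fromCenter ∪
        (S.sigma fun p => {i | corner p i = Sum.inr q}).image fromCorner : Finset DartLabel) := by
    ext ⟨_ | p, i, _ | _⟩
    · simp [fromCenter, fromCorner]
    · simp [fromCenter, fromCorner]
    · simp [fromCenter, fromCorner]
    · suffices p = q → p ∈ S by simpa [fromCenter, fromCorner, eq_comm] using this
      rintro rfl
      exact hq
  have hdisj : Disjoint (Finset.univ.image fromCenter)
      ((S.sigma fun p => {i | corner p i = Sum.inr q}).image fromCorner) := by
    simp [fromCenter, fromCorner, Finset.disjoint_left]
  rw [h, Set.ncard_coe_finset, Finset.card_union_of_disjoint hdisj,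
    Finset.card_image_of_injective _ fun i j h => by simpa [fromCenter] using h,
    Finset.card_image_of_injective _ (by rintro ⟨p, i⟩ ⟨p', i'⟩ h; simpa [fromCorner] using h),
    Finset.card_sigma, Finset.card_univ, Fintype.card_fin, cornerCount]

end StackCode

theorem apply_eq_of_sameCycle {α β : Type*} {σ : Perm α} {f : α → β} (hf : ∀ x, f (σ x) = f x)
    {x y : α} (h : σ.SameCycle x y) : f x = f y := by
  obtain ⟨z, rfl⟩ := h
  induction z using Int.induction_on with
  | zero => rfl
  | succ n ih => rw [add_comm, zpow_one_add, Perm.mul_apply, hf, ih]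
  | pred n ih =>
    rw [← hf ((σ ^ (-(n : ℤ) - 1)) x), ← Perm.mul_apply, ← zpow_one_add, add_sub_cancel, ih]

namespace RootedMap

open StackCode

variable {D D' : Type} {S S' : Finset (List (Fin 3))}

theorem face_eq_iff (M : RootedMap D) {x y : D} : M.face x = y ↔ M.next y = M.rev x := by
  rw [face, Perm.mul_apply, Perm.inv_eq_iff_eq, eq_comm]

theorem face_rev_next (M : RootedMap D) (d : D) : M.face (M.rev (M.next d)) = d :=
  M.face_eq_iff.2 (M.rev_rev _).symm

theorem origin_next (M : RootedMap D) (d : D) : M.origin (M.next d) = M.origin d :=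
  origin_eq.2 (Perm.sameCycle_apply_left.2 (Perm.SameCycle.refl _ _))

/-! ### Labellings of the darts by positions in the ternary tree -/

/-- `ℓ` identifies the darts of `M` with the labels of the darts of the map in which vertices have
been inserted in the faces that belong to `S`. -/
structure IsLabelling (S : Finset (List (Fin 3))) (M : RootedMap D) (ℓ : D → DartLabel) : Prop where
  tree : IsTree S
  inj : Function.Injective ℓ
  mem_range : ∀ u, u ∈ Set.range ℓ ↔ InDarts S u
  map_rev : ∀ d, ℓ (M.rev d) = reverse (ℓ d)
  map_root : ℓ M.root = (none, 0, true)
  map_face : ∀ p i d, IsLeaf S p → ℓ d = side p i → ℓ (M.face d) = side p (i + 1)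
  map_face_outer : ∀ i d, ℓ d = (none, i, false) → ℓ (M.face d) = (none, i - 1, false)
  origin_of : ∀ d d', source (ℓ d) = source (ℓ d') → M.origin d = M.origin d'

namespace IsLabelling

variable {M : RootedMap D} {N : RootedMap D'} {ℓ : D → DartLabel} {ℓ' : D' → DartLabel}

theorem inDarts (h : IsLabelling S M ℓ) (d : D) : InDarts S (ℓ d) := (h.mem_range _).1 ⟨d, rfl⟩

theorem cover (h : IsLabelling S M ℓ) (d : D) :
    (∃ i, ℓ d = (none, i, false)) ∨ ∃ p i, IsLeaf S p ∧ ℓ d = side p i := (h.inDarts d).cover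

theorem source_face (h : IsLabelling S M ℓ) (d : D) :
    source (ℓ (M.face d)) = source (reverse (ℓ d)) := by
  rcases h.cover d with ⟨i, hi⟩ | ⟨p, i, hp, hi⟩
  · rw [h.map_face_outer i d hi, hi]
    simp
  · rw [h.map_face p i d hp hi, hi, source_reverse_side, source_side]

theorem source_next (h : IsLabelling S M ℓ) (d : D) : source (ℓ (M.next d)) = source (ℓ d) := by
  have := h.source_face (M.rev (M.next d))
  rw [face_rev_next, ← h.map_rev, M.rev_rev] at this
  exact this.symm

theorem origin_iff (h : IsLabelling S M ℓ) {d d' : D} :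
    M.origin d = M.origin d' ↔ source (ℓ d) = source (ℓ d') :=
  ⟨fun hd => apply_eq_of_sameCycle (f := source ∘ ℓ) h.source_next (origin_eq.1 hd),
    h.origin_of d d'⟩

theorem map_rev_root (h : IsLabelling S M ℓ) : ℓ (M.rev M.root) = (none, 0, false) := by
  rw [h.map_rev, h.map_root]
  rfl

theorem map_face_outer_iff (h : IsLabelling S M ℓ) {d : D} :
    (∃ i, ℓ (M.face d) = (none, i, false)) ↔ ∃ i, ℓ d = (none, i, false) := by
  constructor
  · rintro ⟨i, hi⟩
    refine (h.cover d).resolve_right ?_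
    rintro ⟨p, j, hp, hj⟩
    exact side_ne_outer _ _ _ ((h.map_face p j d hp hj).symm.trans hi)
  · rintro ⟨i, hi⟩
    exact ⟨i - 1, h.map_face_outer i d hi⟩

theorem inInfiniteFace_iff (h : IsLabelling S M ℓ) {d : D} :
    M.InInfiniteFace d ↔ ∃ i, ℓ d = (none, i, false) := by
  constructor
  · intro hd
    rw [← apply_eq_of_sameCycle (f := fun d => ∃ i, ℓ d = (none, i, false))
      (fun _ => propext h.map_face_outer_iff) hd]
    exact ⟨0, h.map_rev_root⟩
  · rintro ⟨i, hi⟩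
    have h₂ := h.map_face_outer _ _ h.map_rev_root
    have h₁ := h.map_face_outer _ _ h₂
    have hroot : M.InInfiniteFace (M.rev M.root) := Perm.SameCycle.refl _ _
    have hface {x : D} (hx : M.InInfiniteFace x) : M.InInfiniteFace (M.face x) :=
      Perm.sameCycle_apply_right.2 hx
    match i with
    | 0 => rwa [h.inj (hi.trans h.map_rev_root.symm)]
    | 1 => rw [h.inj (hi.trans h₁.symm)]; exact hface (hface hroot)
    | 2 => rw [h.inj (hi.trans h₂.symm)]; exact hface hroot

theorem exists_isLeaf (h : IsLabelling S M ℓ) {d : D} (hd : ¬ M.InInfiniteFace d) :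
    ∃ p i, IsLeaf S p ∧ ℓ d = side p i :=
  (h.cover d).resolve_left fun hi => hd (h.inInfiniteFace_iff.2 hi)

theorem of_iso (h : IsLabelling S M ℓ) (e : Iso M N) : IsLabelling S N (ℓ ∘ e.toEquiv.symm) where
  tree := h.tree
  inj := h.inj.comp e.toEquiv.symm.injective
  mem_range u := by rw [← h.mem_range, e.toEquiv.symm.surjective.range_comp]
  map_rev d := (congrArg ℓ (e.symm.map_rev d)).trans (h.map_rev _)
  map_root := (congrArg ℓ e.symm.map_root).trans h.map_root
  map_face p i d hp hd := (congrArg ℓ (e.symm.map_face d)).trans (h.map_face p i _ hp hd)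
  map_face_outer i d hd := (congrArg ℓ (e.symm.map_face d)).trans (h.map_face_outer i _ hd)
  origin_of d d' hd :=
    origin_eq.2 ((Iso.sameCycle _ e.symm.map_next d d').1 (origin_eq.1 (h.origin_of _ _ hd)))

theorem map_face_eq (h : IsLabelling S M ℓ) (h' : IsLabelling S N ℓ') {d : D} {d' : D'}
    (hd : ℓ' d' = ℓ d) : ℓ' (N.face d') = ℓ (M.face d) := by
  rcases h.cover d with ⟨i, hi⟩ | ⟨p, i, hp, hi⟩
  · rw [h.map_face_outer i d hi, h'.map_face_outer i _ (hd.trans hi)]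
  · rw [h.map_face p i d hp hi, h'.map_face p i _ hp (hd.trans hi)]

theorem map_next_eq (h : IsLabelling S M ℓ) (h' : IsLabelling S N ℓ') {d : D} {d' : D'}
    (hd : ℓ' d' = ℓ d) : ℓ' (N.next d') = ℓ (M.next d) := by
  obtain ⟨x, hx⟩ := (h'.mem_range _).2 (h.inDarts (M.rev (M.next d)))
  have hface : N.face x = d' := h'.inj (by rw [h.map_face_eq h' hx, face_rev_next, hd])
  rw [N.face_eq_iff.1 hface, h'.map_rev, hx, ← h.map_rev, M.rev_rev]

theorem nonempty_iso (h : IsLabelling S M ℓ) (h' : IsLabelling S N ℓ') : Nonempty (Iso M N) := by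
  choose φ hφ using fun d => (h'.mem_range _).2 (h.inDarts d)
  have hbij : Function.Bijective φ := by
    refine ⟨fun a b hab => h.inj (by rw [← hφ, ← hφ, hab]), fun d' => ?_⟩
    obtain ⟨d, hd⟩ := (h.mem_range _).2 (h'.inDarts d')
    exact ⟨d, h'.inj (by rw [hφ, hd])⟩
  exact ⟨{
    toEquiv := Equiv.ofBijective φ hbij
    map_next := fun d => h'.inj ((hφ _).trans (h.map_next_eq h' (hφ d)).symm)
    map_rev := fun d => h'.inj (show ℓ' (φ (M.rev d)) = ℓ' (N.rev (φ d)) by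
      rw [hφ, h.map_rev, h'.map_rev, hφ])
    map_root := h'.inj ((hφ _).trans (h.map_root.trans h'.map_root.symm)) }⟩

theorem triangle : IsLabelling ∅ triangle (fun d => (none, d)) where
  tree _ _ h := absurd h (Finset.notMem_empty _)
  inj := Prod.mk_right_injective none
  mem_range := by
    rintro ⟨_ | p, d⟩ <;> simp
  map_rev _ := rfl
  map_root := rfl
  map_face p i d hp hd := by
    obtain rfl := isLeaf_empty.1 hp
    obtain rfl := (Prod.mk.inj hd).2
    revert i
    decide
  map_face_outer i d hd := by
    obtain rfl := (Prod.mk.inj hd).2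
    revert i
    decide
  origin_of d d' h := by
    have key : ∀ d d' : Fin 3 × Bool, source (none, d) = source (none, d') →
        d = d' ∨ d = RootedMap.triangle.next d' := by decide
    rcases key d d' h with rfl | rfl
    · rfl
    · exact origin_next _ _

end IsLabelling

/-! ### Insertion of a vertex -/

/-- The three boundary darts of a triangular face, from the dart `f` on. -/
def boundary (M : RootedMap D) (f : D) : Fin 3 → D := ![f, M.face f, M.face (M.face f)]

section Insertion

variable (M : RootedMap D) {f : D}

theorem face_boundary (h₃ : M.face (M.face (M.face f)) = f) :
    ∀ j, M.face (M.boundary f j) = M.boundary f (j + 1)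
  | 0 => rfl
  | 1 => rfl
  | 2 => h₃

theorem insert_next_boundary (hinj : Function.Injective (M.boundary f)) (j : Fin 3) :
    (M.insertVertex f).next (Sum.inl (M.boundary f j)) = Sum.inr (j, false) := by
  have h₀₁ : f ≠ M.face f := hinj.ne (a₁ := 0) (a₂ := 1) (by decide)
  have h₀₂ : f ≠ M.face (M.face f) := hinj.ne (a₁ := 0) (a₂ := 2) (by decide)
  have h₁₂ : M.face f ≠ M.face (M.face f) := hinj.ne (a₁ := 1) (a₂ := 2) (by decide)
  fin_cases j <;>
    simp [insertVertex, boundary, exch, swap_apply_def, spin, h₀₁, h₀₂, h₁₂]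

theorem insert_next_to_new (hinj : Function.Injective (M.boundary f)) (j : Fin 3) :
    (M.insertVertex f).next (Sum.inr (j, false)) = Sum.inl (M.next (M.boundary f j)) := by
  have h₀₁ : f ≠ M.face f := hinj.ne (a₁ := 0) (a₂ := 1) (by decide)
  have h₀₂ : f ≠ M.face (M.face f) := hinj.ne (a₁ := 0) (a₂ := 2) (by decide)
  have h₁₂ : M.face f ≠ M.face (M.face f) := hinj.ne (a₁ := 1) (a₂ := 2) (by decide)
  fin_cases j <;>
    simp [insertVertex, boundary, exch, swap_apply_def, h₀₁.symm, h₀₂.symm, h₁₂.symm]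

theorem insert_next_of_notMem_boundary {d : D} (hd : d ∉ Set.range (M.boundary f)) :
    (M.insertVertex f).next (Sum.inl d) = Sum.inl (M.next d) :=
  M.insert_next_inl (fun h => hd ⟨0, h.symm⟩) (fun h => hd ⟨1, h.symm⟩) (fun h => hd ⟨2, h.symm⟩)

theorem insert_face_of_notMem_boundary (h₃ : M.face (M.face (M.face f)) = f) {d : D}
    (hd : d ∉ Set.range (M.boundary f)) :
    (M.insertVertex f).face (Sum.inl d) = Sum.inl (M.face d) := by
  have hd' : M.face d ∉ Set.range (M.boundary f) := by
    rintro ⟨j, hj⟩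
    refine hd ⟨j - 1, M.face.injective ?_⟩
    rw [← hj, M.face_boundary h₃, sub_add_cancel]
  rw [face_eq_iff, M.insert_next_of_notMem_boundary hd', M.face_eq_iff.1 rfl]
  rfl

theorem insert_face_boundary (h₃ : M.face (M.face (M.face f)) = f)
    (hinj : Function.Injective (M.boundary f)) (j : Fin 3) :
    (M.insertVertex f).face (Sum.inl (M.boundary f j)) = Sum.inr (j + 1, false) := by
  rw [face_eq_iff, M.insert_next_to_new hinj, M.face_eq_iff.1 (M.face_boundary h₃ j)]
  rfl

theorem insert_face_to_new (f : D) (j : Fin 3) :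
    (M.insertVertex f).face (Sum.inr (j + 1, false)) = Sum.inr (j, true) := by
  rw [face_eq_iff, insert_next_new]
  rfl

theorem insert_face_from_new (hinj : Function.Injective (M.boundary f)) (j : Fin 3) :
    (M.insertVertex f).face (Sum.inr (j, true)) = Sum.inl (M.boundary f j) := by
  rw [face_eq_iff, M.insert_next_boundary hinj]
  rfl

theorem insert_origin_to_new (hinj : Function.Injective (M.boundary f)) (j : Fin 3) :
    (M.insertVertex f).origin (Sum.inr (j, false)) =
      (M.insertVertex f).origin (Sum.inl (M.boundary f j)) := by
  rw [← M.insert_next_boundary hinj, origin_next]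

theorem insert_origin_from_new (f : D) (j : Fin 3) :
    (M.insertVertex f).origin (Sum.inr (j, true)) =
      (M.insertVertex f).origin (Sum.inr (0, true)) := by
  have hstep (j : Fin 3) : (M.insertVertex f).origin (Sum.inr (j + 1, true)) =
      (M.insertVertex f).origin (Sum.inr (j, true)) := by
    rw [← M.insert_next_new f, origin_next]
  match j with
  | 0 => rfl
  | 1 => exact hstep 0
  | 2 => exact (hstep 1).trans (hstep 0)

theorem insert_origin_inl (hinj : Function.Injective (M.boundary f)) {d d' : D}
    (h : M.origin d = M.origin d') :
    (M.insertVertex f).origin (Sum.inl d) = (M.insertVertex f).origin (Sum.inl d') := by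
  refine apply_eq_of_sameCycle (f := (M.insertVertex f).origin ∘ Sum.inl) (fun x => ?_)
    (origin_eq.1 h)
  simp only [Function.comp_apply]
  by_cases hx : x ∈ Set.range (M.boundary f)
  · obtain ⟨j, rfl⟩ := hx
    rw [← M.insert_next_to_new hinj, origin_next, M.insert_origin_to_new hinj]
  · rw [← M.insert_next_of_notMem_boundary hx, origin_next]

end Insertion

/-- The labels after an insertion in the face `p`, at the dart `side p i`. -/
def insertLabel (ℓ : D → DartLabel) (p : List (Fin 3)) (i : Fin 3) : D ⊕ Fin 3 × Bool → DartLabel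
  | Sum.inl d => ℓ d
  | Sum.inr (j, b) => (some p, j + i, b)

theorem mem_range_insertLabel {ℓ : D → DartLabel} {p : List (Fin 3)} {i : Fin 3} {u : DartLabel} :
    u ∈ Set.range (insertLabel ℓ p i) ↔ u ∈ Set.range ℓ ∨ u.1 = some p := by
  constructor
  · rintro ⟨d | ⟨j, b⟩, rfl⟩
    · exact Or.inl ⟨d, rfl⟩
    · exact Or.inr rfl
  · rintro (⟨d, rfl⟩ | hu)
    · exact ⟨Sum.inl d, rfl⟩
    · obtain ⟨_, j, b⟩ := u
      obtain rfl := hu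
      exact ⟨Sum.inr (j - i, b), by simp [insertLabel]⟩

namespace IsLabelling

variable {M : RootedMap D} {ℓ : D → DartLabel} {p : List (Fin 3)} {i : Fin 3} {f : D}

theorem label_boundary (h : IsLabelling S M ℓ) (hp : IsLeaf S p) (hf : ℓ f = side p i)
    (j : Fin 3) : ℓ (M.boundary f j) = side p (j + i) := by
  have h₁ := h.map_face p i f hp hf
  have h₂ := h.map_face p _ _ hp h₁
  match j with
  | 0 => rwa [zero_add]
  | 1 => rwa [add_comm]
  | 2 => rwa [add_assoc, add_comm] at h₂

theorem boundary_injective (h : IsLabelling S M ℓ) (hp : IsLeaf S p) (hf : ℓ f = side p i) :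
    Function.Injective (M.boundary f) := by
  intro a b hab
  have := congrArg ℓ hab
  rw [h.label_boundary hp hf, h.label_boundary hp hf] at this
  exact add_right_cancel (hp.side_inj h.tree hp this).2

theorem face_face_face (h : IsLabelling S M ℓ) (hp : IsLeaf S p) (hf : ℓ f = side p i) :
    M.face (M.face (M.face f)) = f := by
  refine h.inj ((h.map_face p _ _ hp (h.label_boundary hp hf 2)).trans ?_)
  rw [hf, add_right_comm, (by decide : (2 + 1 : Fin 3) = 0), zero_add]

theorem source_ne_inr (h : IsLabelling S M ℓ) (hp : p ∉ S) (d : D) : source (ℓ d) ≠ Sum.inr p :=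
  fun hd => hp (mem_of_source_eq_inr h.tree (h.inDarts d) hd)

theorem insertLabel_injective (h : IsLabelling S M ℓ) (hp : p ∉ S) (i : Fin 3) :
    Function.Injective (insertLabel ℓ p i) := by
  have hold (d : D) : (ℓ d).1 ≠ some p := fun hd => hp (h.inDarts d p hd)
  rintro (d | ⟨j, b⟩) (d' | ⟨j', b'⟩) hd
  · exact congrArg _ (h.inj hd)
  · exact absurd (congrArg Prod.fst hd) (hold d)
  · exact absurd (congrArg Prod.fst hd).symm (hold d')
  · simpa [insertLabel] using hd

theorem insert_map_face_old (h : IsLabelling S M ℓ) (hp : IsLeaf S p) (hf : ℓ f = side p i)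
    {q : List (Fin 3)} (hq : IsLeaf S q) (hqp : q ≠ p) {j : Fin 3} {x : D ⊕ Fin 3 × Bool}
    (hx : insertLabel ℓ p i x = side q j) :
    insertLabel ℓ p i ((M.insertVertex f).face x) = side q (j + 1) := by
  obtain ⟨d, hd⟩ := (h.mem_range (side q j)).2 (side_inDarts h.tree hq.2 j)
  obtain rfl : x = Sum.inl d := h.insertLabel_injective hp.1 i (hx.trans hd.symm)
  have hdf : d ∉ Set.range (M.boundary f) := by
    rintro ⟨j', rfl⟩
    rw [h.label_boundary hp hf] at hd
    exact hqp (hp.side_inj h.tree hq hd).1.symm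
  rw [M.insert_face_of_notMem_boundary (h.face_face_face hp hf) hdf]
  exact h.map_face q j d hq hd

theorem insert_map_face_new (h : IsLabelling S M ℓ) (hp : IsLeaf S p) (hf : ℓ f = side p i)
    (c : Fin 3) {j : Fin 3} {x : D ⊕ Fin 3 × Bool} (hx : insertLabel ℓ p i x = side (c :: p) j) :
    insertLabel ℓ p i ((M.insertVertex f).face x) = side (c :: p) (j + 1) := by
  have hinj := h.boundary_injective hp hf
  have hb := h.label_boundary hp hf
  have hx_eq {y} (hy : insertLabel ℓ p i y = side (c :: p) j) : x = y :=
    h.insertLabel_injective hp.1 i (hx.trans hy.symm)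
  obtain ⟨a, rfl⟩ : ∃ a, c = a + i := ⟨c - i, by simp⟩
  match j with
  | 0 =>
    obtain rfl := hx_eq (y := Sum.inl (M.boundary f a)) (hb a)
    rw [M.insert_face_boundary (h.face_face_face hp hf) hinj]
    simp [insertLabel, add_right_comm]
  | 1 =>
    obtain rfl := hx_eq (y := Sum.inr (a + 1, false)) (by simp [insertLabel, add_right_comm])
    rw [M.insert_face_to_new f]
    rfl
  | 2 =>
    obtain rfl := hx_eq (y := Sum.inr (a, true)) rfl
    rw [M.insert_face_from_new hinj]
    exact hb a

theorem insert_map_face_outer (h : IsLabelling S M ℓ) (hp : IsLeaf S p) (hf : ℓ f = side p i)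
    {j : Fin 3} : ∀ {x : D ⊕ Fin 3 × Bool}, insertLabel ℓ p i x = (none, j, false) →
      insertLabel ℓ p i ((M.insertVertex f).face x) = (none, j - 1, false)
  | Sum.inl d, hd => by
    have hdf : d ∉ Set.range (M.boundary f) := by
      rintro ⟨j', rfl⟩
      exact side_ne_outer _ _ _ ((h.label_boundary hp hf j').symm.trans hd)
    rw [M.insert_face_of_notMem_boundary (h.face_face_face hp hf) hdf]
    exact h.map_face_outer j d hd
  | Sum.inr _, hd => by simp [insertLabel] at hd

theorem exists_inl_origin_eq (h : IsLabelling S M ℓ) (hp : IsLeaf S p) (hf : ℓ f = side p i) :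
    ∀ x : D ⊕ Fin 3 × Bool, (∃ j, x = Sum.inr (j, true)) ∨
      ∃ d, (M.insertVertex f).origin x = (M.insertVertex f).origin (Sum.inl d) ∧
        source (insertLabel ℓ p i x) = source (ℓ d)
  | Sum.inl d => Or.inr ⟨d, rfl, rfl⟩
  | Sum.inr (j, false) => by
    refine Or.inr ⟨_, M.insert_origin_to_new (h.boundary_injective hp hf) j, ?_⟩
    rw [h.label_boundary hp hf, source_side]
    rfl
  | Sum.inr (j, true) => Or.inl ⟨j, rfl⟩

theorem insert_origin_of (h : IsLabelling S M ℓ) (hp : IsLeaf S p) (hf : ℓ f = side p i)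
    {x y : D ⊕ Fin 3 × Bool} (hxy : source (insertLabel ℓ p i x) = source (insertLabel ℓ p i y)) :
    (M.insertVertex f).origin x = (M.insertVertex f).origin y := by
  rcases h.exists_inl_origin_eq hp hf x with ⟨j, rfl⟩ | ⟨d, hx, hx'⟩ <;>
    rcases h.exists_inl_origin_eq hp hf y with ⟨j', rfl⟩ | ⟨d', hy, hy'⟩
  · rw [insert_origin_from_new, insert_origin_from_new M f j']
  · exact absurd (hy'.symm.trans hxy.symm) (h.source_ne_inr hp.1 d')
  · exact absurd (hx'.symm.trans hxy) (h.source_ne_inr hp.1 d)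
  · rw [hx, hy]
    exact M.insert_origin_inl (h.boundary_injective hp hf) (h.origin_of d d' (by
      rw [← hx', ← hy', hxy]))

theorem insert (h : IsLabelling S M ℓ) (hp : IsLeaf S p) (hf : ℓ f = side p i) :
    IsLabelling (insert p S) (M.insertVertex f) (insertLabel ℓ p i) where
  tree := h.tree.insert hp.2
  inj := h.insertLabel_injective hp.1 i
  mem_range u := by rw [mem_range_insertLabel, inDarts_insert_iff, h.mem_range]
  map_rev
    | Sum.inl d => h.map_rev d
    | Sum.inr _ => rfl
  map_root := h.map_root
  map_face q j x hq hx := by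
    rcases hq.of_insert with ⟨hqS, hqp⟩ | ⟨c, rfl⟩
    · exact h.insert_map_face_old hp hf hqS hqp hx
    · exact h.insert_map_face_new hp hf c hx
  map_face_outer _ _ := h.insert_map_face_outer hp hf
  origin_of _ _ := h.insert_origin_of hp hf

end IsLabelling

/-! ### The labels of the vertices are determined by the map -/

namespace IsLabelling

variable {M : RootedMap D} {ℓ ℓ' : D → DartLabel}

theorem exists_source_eq_inl (h : IsLabelling S M ℓ) (h' : IsLabelling S' M ℓ') :
    ∀ i, ∃ d, source (ℓ d) = Sum.inl i ∧ source (ℓ' d) = Sum.inl i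
  | 0 => ⟨M.root, by rw [h.map_root, source], by rw [h'.map_root, source]⟩
  | 1 => ⟨M.rev M.root, by rw [h.map_rev_root]; rfl, by rw [h'.map_rev_root]; rfl⟩
  | 2 => ⟨M.face (M.face (M.rev M.root)),
      by rw [h.map_face_outer _ _ (h.map_face_outer _ _ h.map_rev_root)]; rfl,
      by rw [h'.map_face_outer _ _ (h'.map_face_outer _ _ h'.map_rev_root)]; rfl⟩

theorem source_eq_inl (h : IsLabelling S M ℓ) (h' : IsLabelling S' M ℓ') {d : D} {i : Fin 3}
    (hd : source (ℓ d) = Sum.inl i) : source (ℓ' d) = Sum.inl i := by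
  obtain ⟨e, he, he'⟩ := h.exists_source_eq_inl h' i
  rw [← he', ← h'.origin_iff, h.origin_iff, hd, he]

theorem exists_dart (h : IsLabelling S M ℓ) {p : List (Fin 3)} (hp : p ∈ S) (x : Fin 3 × Bool) :
    ∃ d, ℓ d = (some p, x) := (h.mem_range _).2 (inDarts_some.2 hp)

theorem exists_origin_eq_source_rev (h : IsLabelling S M ℓ) {d : D} {p : List (Fin 3)}
    (hd : source (ℓ d) = Sum.inr p) (j : Fin 3) :
    ∃ g, M.origin g = M.origin d ∧ source (ℓ (M.rev g)) = corner p j := by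
  obtain ⟨g, hg⟩ := h.exists_dart (mem_of_source_eq_inr h.tree (h.inDarts d) hd) (j, true)
  exact ⟨g, h.origin_iff.2 (by rw [hg, hd]; rfl), by rw [h.map_rev, hg]; rfl⟩

theorem source_eq_inr (h : IsLabelling S M ℓ) (h' : IsLabelling S' M ℓ') {d : D}
    {p : List (Fin 3)} (hd : source (ℓ d) = Sum.inr p) : source (ℓ' d) = Sum.inr p := by
  induction hn : p.length using Nat.strong_induction_on generalizing S S' ℓ ℓ' d p with
  | _ n ih =>
  have hcorner {e : D} {j : Fin 3} (he : source (ℓ e) = corner p j) :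
      source (ℓ' e) = corner p j := by
    cases hc : corner p j with
    | inl i => exact h.source_eq_inl h' (he.trans hc)
    | inr r => exact ih _ (hn ▸ length_lt_of_corner_eq_inr hc) h h' (he.trans hc) rfl
  cases hq : source (ℓ' d) with
  | inl i => exact absurd (hd.symm.trans (h'.source_eq_inl h hq)) Sum.inr_ne_inl
  | inr q =>
    have hpq : p.length ≤ q.length := by
      by_contra! hlt
      obtain rfl := Sum.inr.inj (hd.symm.trans (ih _ (hn ▸ hlt) h' h hq rfl))
      exact lt_irrefl _ hlt
    rw [eq_of_range_corner_subset (p := p) (q := q)]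
    rintro _ ⟨j, rfl⟩
    obtain ⟨g, hg, hj⟩ := h.exists_origin_eq_source_rev hd j
    have hj' := hcorner hj
    rw [h'.map_rev] at hj'
    rw [← hj']
    refine (source_reverse_of_source_eq_inr ((h'.origin_iff.1 hg).trans hq)).resolve_right ?_
    rintro ⟨r, hr, hlt⟩
    have := length_lt_of_corner_eq_inr (hj'.symm.trans hr)
    omega

theorem subset (h : IsLabelling S M ℓ) (h' : IsLabelling S' M ℓ') : S ⊆ S' := by
  intro p hp
  obtain ⟨d, hd⟩ := h.exists_dart hp (0, true)
  exact mem_of_source_eq_inr h'.tree (h'.inDarts d) (h.source_eq_inr h' (by rw [hd]; rfl))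

theorem tree_unique (h : IsLabelling S M ℓ) (h' : IsLabelling S' M ℓ') : S = S' :=
  (h.subset h').antisymm (h'.subset h)

/-! ### Degrees and internal vertices -/

theorem degree_eq (h : IsLabelling S M ℓ) {d : D} {q : List (Fin 3)}
    (hd : source (ℓ d) = Sum.inr q) :
    M.degree (M.origin d) = 3 + cornerCount S (Sum.inr q) := by
  rw [← ncard_source_eq_inr (mem_of_source_eq_inr h.tree (h.inDarts d) hd), degree,
    ← Set.ncard_image_of_injective _ h.inj]
  congr 1
  ext u
  constructor
  · rintro ⟨e, he, rfl⟩
    exact ⟨h.inDarts e, (h.origin_iff.1 he).trans hd⟩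
  · rintro ⟨hu, hs⟩
    obtain ⟨e, rfl⟩ := (h.mem_range u).2 hu
    exact ⟨e, h.origin_iff.2 (hs.trans hd.symm), rfl⟩

theorem isInternal_iff (h : IsLabelling S M ℓ) {d : D} :
    M.IsInternal (M.origin d) ↔ ∃ q, source (ℓ d) = Sum.inr q := by
  constructor
  · intro hd
    cases hs : source (ℓ d) with
    | inr q => exact ⟨q, rfl⟩
    | inl i =>
      obtain ⟨e, he⟩ := (h.mem_range (none, i - 1, false)).2 (inDarts_none _)
      refine absurd (h.inInfiniteFace_iff.2 ⟨_, he⟩) (hd e (h.origin_iff.2 ?_))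
      rw [he, hs]
      simp
  · rintro ⟨q, hq⟩ e he hinf
    obtain ⟨i, hi⟩ := h.inInfiniteFace_iff.1 hinf
    rw [h.origin_iff, hi, hq] at he
    cases he

end IsLabelling

/-! ### The tree of a stack-triangulation -/

theorem IsStack.exists_isLabelling {k : ℕ} {M : RootedMap D} (h : IsStack k M) :
    ∃ S ℓ, IsLabelling S M ℓ ∧ S.card + 1 = k := by
  induction h with
  | base => exact ⟨_, _, IsLabelling.triangle, rfl⟩
  | step f _ hf ih =>
    obtain ⟨S, ℓ, h, rfl⟩ := ih
    obtain ⟨p, i, hp, hi⟩ := h.exists_isLeaf hf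
    exact ⟨_, _, h.insert hp hi, by rw [Finset.card_insert_of_notMem hp.1]⟩
  | iso e _ ih =>
    obtain ⟨S, ℓ, h, hk⟩ := ih
    exact ⟨_, _, h.of_iso e, hk⟩

theorem IsLabelling.exists_dart_of_isLeaf {M : RootedMap D} {ℓ : D → DartLabel}
    (h : IsLabelling S M ℓ) {p : List (Fin 3)} (hp : IsLeaf S p) :
    ∃ f, ℓ f = side p 0 ∧ ¬ M.InInfiniteFace f := by
  obtain ⟨f, hf⟩ := (h.mem_range _).2 (side_inDarts h.tree hp.2 0)
  refine ⟨f, hf, fun hinf => ?_⟩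
  obtain ⟨i, hi⟩ := h.inInfiniteFace_iff.1 hinf
  exact side_ne_outer p 0 i (hf.symm.trans hi)

theorem exists_isLabelling_of_isTree {n : ℕ} {S : Finset (List (Fin 3))} (hS : IsTree S)
    (hn : S.card = n) :
    ∃ (M : RootedMap (Fin (6 * (n + 1)))) (ℓ : _), IsStack (n + 1) M ∧ IsLabelling S M ℓ := by
  induction n generalizing S with
  | zero =>
    obtain rfl := Finset.card_eq_zero.1 hn
    have e : Fin 3 × Bool ≃ Fin (6 * (0 + 1)) := Fintype.equivFinOfCardEq (by simp)
    exact ⟨_, _, IsStack.base.iso (triangle.relabelIso e),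
      IsLabelling.triangle.of_iso (triangle.relabelIso e)⟩
  | succ n ih =>
    obtain ⟨p, hp, hmax⟩ := S.exists_max_image List.length (Finset.card_pos.1 (by omega))
    obtain ⟨M, ℓ, hM, h⟩ := ih (hS.erase hmax) (by rw [Finset.card_erase_of_mem hp, hn]; rfl)
    obtain ⟨f, hf, hinf⟩ := h.exists_dart_of_isLeaf (hS.isLeaf_erase hp)
    have e : Fin (6 * (n + 1)) ⊕ Fin 3 × Bool ≃ Fin (6 * (n + 1 + 1)) :=
      Fintype.equivFinOfCardEq (by simp; ring)
    have hins := (h.insert (hS.isLeaf_erase hp) hf).of_iso ((M.insertVertex f).relabelIso e)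
    rw [Finset.insert_erase hp] at hins
    exact ⟨_, _, (IsStack.step f hM hinf).iso ((M.insertVertex f).relabelIso e), hins⟩

theorem IsFirstInserted.exists_isLabelling {M : RootedMap D} {v : M.Vertex}
    (h : IsFirstInserted M v) :
    ∃ S ℓ, IsLabelling S M ℓ ∧ ∃ d, M.origin d = v ∧ source (ℓ d) = Sum.inr [] := by
  induction h with
  | base f hf =>
    obtain ⟨p, i, hp, hi⟩ := IsLabelling.triangle.exists_isLeaf hf
    obtain rfl := isLeaf_empty.1 hp
    exact ⟨_, _, IsLabelling.triangle.insert hp hi, _, rfl, rfl⟩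
  | step f d _ hf ih =>
    obtain ⟨S, ℓ, h, e, he, hs⟩ := ih
    obtain ⟨p, i, hp, hi⟩ := h.exists_isLeaf hf
    exact ⟨_, _, h.insert hp hi, Sum.inl d, rfl, (h.origin_iff.1 he).symm.trans hs⟩
  | iso e d _ ih =>
    obtain ⟨S, ℓ, h, d', hd, hs⟩ := ih
    refine ⟨_, _, h.of_iso e, e.toEquiv d, rfl, ?_⟩
    rw [Function.comp_apply, Equiv.symm_apply_apply, ← h.origin_iff.1 hd, hs]

theorem IsFirstInserted.degree_eq {M : RootedMap D} {v : M.Vertex} (h : IsFirstInserted M v)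
    {ℓ : D → DartLabel} (hℓ : IsLabelling S M ℓ) :
    M.degree v = 3 + cornerCount S (Sum.inr []) := by
  obtain ⟨S', ℓ', h', d, rfl, hd⟩ := h.exists_isLabelling
  exact hℓ.degree_eq (h'.source_eq_inr hℓ hd)

end RootedMap

namespace StackTriangulation

open RootedMap StackCode

variable {n : ℕ}

/-- The nodes of the tree associated with a stack-triangulation. -/
noncomputable def tree (t : StackTriangulation n) : Finset (List (Fin 3)) :=
  t.rep_isStack.exists_isLabelling.choose

/-- The labelling of the darts by the tree. -/
noncomputable def label (t : StackTriangulation n) : Fin (6 * n) → DartLabel :=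
  t.rep_isStack.exists_isLabelling.choose_spec.choose

theorem isLabelling (t : StackTriangulation n) : IsLabelling t.tree t.rep t.label :=
  t.rep_isStack.exists_isLabelling.choose_spec.choose_spec.1

theorem card_tree (t : StackTriangulation n) : t.tree.card + 1 = n :=
  t.rep_isStack.exists_isLabelling.choose_spec.choose_spec.2

theorem tree_injective : Function.Injective (tree : StackTriangulation n → _) := by
  intro t t' h
  have hiso := (h ▸ t.isLabelling).nonempty_iso t'.isLabelling
  rw [← Quotient.out_eq t, ← Quotient.out_eq t']
  exact Quotient.sound hiso

theorem exists_tree_eq {S : Finset (List (Fin 3))} (hS : IsTree S) (hn : S.card = n) :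
    ∃ t : StackTriangulation (n + 1), t.tree = S := by
  obtain ⟨M, ℓ, hM, h⟩ := exists_isLabelling_of_isTree hS hn
  obtain ⟨e⟩ := Quotient.exact (Quotient.out_eq (Quotient.mk (stackSetoid (n + 1)) ⟨M, hM⟩))
  exact ⟨_, (isLabelling _).tree_unique (h.of_iso e.symm)⟩

/-- The internal vertices are in bijection with the nodes of the tree. -/
theorem exists_vertexEquiv (t : StackTriangulation n) :
    ∃ e : t.tree ≃ t.InternalVertex,
      ∀ q, t.rep.degree (e q).1 = 3 + cornerCount t.tree (Sum.inr q.1) := by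
  have h := t.isLabelling
  choose d hd using fun q : t.tree => h.exists_dart q.2 (0, true)
  have hs (q : t.tree) : source (t.label (d q)) = Sum.inr q.1 := by rw [hd, source]
  let φ (q : t.tree) : t.InternalVertex := ⟨t.rep.origin (d q), h.isInternal_iff.2 ⟨_, hs q⟩⟩
  have hφ : Function.Bijective φ := by
    constructor
    · intro q q' hq
      have := h.origin_iff.1 (congrArg Subtype.val hq)
      rw [hs, hs] at this
      exact Subtype.ext (Sum.inr.inj this)
    · rintro ⟨v, hv⟩
      obtain ⟨e, rfl⟩ := Quotient.exists_rep v
      obtain ⟨q, hq⟩ := h.isInternal_iff.1 hv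
      exact ⟨⟨q, mem_of_source_eq_inr h.tree (h.inDarts e) hq⟩,
        Subtype.ext (h.origin_iff.2 ((hs _).trans hq.symm))⟩
  exact ⟨Equiv.ofBijective φ hφ, fun q => h.degree_eq (hs q)⟩

end StackTriangulation

/-- Ternary trees. Those with `n` nodes encode the stack-triangulations with `2 * (n + 1)` faces. -/
inductive TTree : Type
  | leaf : TTree
  | node (child : Fin 3 → TTree) : TTree

namespace TTree

open StackCode

/-- The number of nodes of a tree. -/
@[simp] def size : TTree → ℕ
  | leaf => 0
  | node t => (∑ i, (t i).size) + 1

/-- The number of insertions that increase the degree of the outer corner `i`. -/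
@[simp] def arm : TTree → Fin 3 → ℕ
  | leaf, _ => 0
  | node t, i => 1 + (t i).arm 0 + (t (i - 1)).arm 1

/-- The number of insertions that increase the degree of the first inserted vertex. -/
@[simp] def rootCount : TTree → ℕ
  | leaf => 0
  | node t => ∑ i, (t i).arm 2

/-- The number of nodes whose subtree has a given `rootCount`, that is, the number of internal
vertices of degree `k + 3` of the stack-triangulation. -/
@[simp] def hits (k : ℕ) : TTree → ℕ
  | leaf => 0
  | node t => (if rootCount (node t) = k then 1 else 0) + ∑ i, (t i).hits k

/-! ### Trees as sets of positions -/

/-- The embedding of the `c`-th subtree in the tree: the step `c` is taken first, hence is the last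
element of the list. -/
def graft (c : Fin 3) : List (Fin 3) ↪ List (Fin 3) := ⟨(· ++ [c]), List.append_left_injective [c]⟩

@[simp] theorem graft_apply (c : Fin 3) (p : List (Fin 3)) : graft c p = p ++ [c] := rfl

/-- The positions of the nodes. -/
def nodes : TTree → Finset (List (Fin 3))
  | leaf => ∅
  | node t => insert [] (Finset.univ.biUnion fun i => (t i).nodes.map (graft i))

@[simp] theorem nodes_leaf : leaf.nodes = ∅ := rfl

variable (t : Fin 3 → TTree)

@[simp] theorem nil_mem_nodes : [] ∈ (node t).nodes := Finset.mem_insert_self _ _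

@[simp] theorem append_mem_nodes {i : Fin 3} {p : List (Fin 3)} :
    p ++ [i] ∈ (node t).nodes ↔ p ∈ (t i).nodes := by
  simp [nodes]

theorem sum_nodes {α : Type*} [AddCommMonoid α] (g : List (Fin 3) → α) :
    ∑ p ∈ (node t).nodes, g p = g [] + ∑ i, ∑ p ∈ (t i).nodes, g (p ++ [i]) := by
  rw [nodes, Finset.sum_insert (by simp), Finset.sum_biUnion]
  · simp
  · intro i _ j _ hij
    simp only [Function.onFun, Finset.disjoint_left, Finset.mem_map, graft_apply]
    rintro _ ⟨p, -, rfl⟩ ⟨q, -, h⟩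
    exact hij (by simpa using (List.append_inj' h rfl).2.symm)

theorem isTree_nodes (t : TTree) : IsTree t.nodes := by
  induction t with
  | leaf => simp [IsTree]
  | node t ih =>
    intro d p hp
    induction p using List.reverseRecOn with
    | nil => exact nil_mem_nodes t
    | append_singleton p i =>
      rw [← List.cons_append, append_mem_nodes] at hp
      exact (append_mem_nodes t).2 (ih i d p hp)

theorem card_nodes (t : TTree) : t.nodes.card = t.size := by
  induction t with
  | leaf => rfl
  | node t ih => simp only [Finset.card_eq_sum_ones, sum_nodes, size, ← ih, add_comm]

theorem nodes_injective : Function.Injective nodes := by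
  intro t
  induction t with
  | leaf =>
    rintro (_ | t') h
    · rfl
    · simpa [← h] using nil_mem_nodes t'
  | node t ih =>
    rintro (_ | t') h
    · simpa [h] using nil_mem_nodes t
    · refine congrArg node (funext fun i => ih i ?_)
      ext p
      rw [← append_mem_nodes, h, append_mem_nodes]

theorem card_preimage_graft_lt {S : Finset (List (Fin 3))} (hS : [] ∈ S) (i : Fin 3) :
    (S.preimage (graft i) (graft i).injective.injOn).card < S.card := by
  rw [← Finset.card_map (graft i)]
  refine Finset.card_lt_card ((Finset.ssubset_iff_of_subset ?_).2 ⟨[], hS, by simp⟩)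
  intro q hq
  obtain ⟨p, hp, rfl⟩ := Finset.mem_map.1 hq
  exact Finset.mem_preimage.1 hp

theorem isTree_preimage_graft {S : Finset (List (Fin 3))} (hS : IsTree S) (i : Fin 3) :
    IsTree (S.preimage (graft i) (graft i).injective.injOn) := by
  intro d p hp
  rw [Finset.mem_preimage] at hp ⊢
  exact hS d _ hp

theorem exists_nodes_eq (S : Finset (List (Fin 3))) (hS : IsTree S) : ∃ t : TTree, t.nodes = S := by
  induction hn : S.card using Nat.strong_induction_on generalizing S with
  | _ n ih =>
    subst hn
    rcases S.eq_empty_or_nonempty with rfl | ⟨p, hp⟩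
    · exact ⟨leaf, rfl⟩
    have hnil := hS.nil_mem hp
    choose t ht using fun i =>
      ih _ (card_preimage_graft_lt hnil i) _ (isTree_preimage_graft hS i) rfl
    refine ⟨node t, ?_⟩
    ext p
    induction p using List.reverseRecOn with
    | nil => simp [hnil]
    | append_singleton p i => simp [ht]

/-! ### Recursive computation of the degrees -/

/-- The vertices as seen from the `c`-th subtree of the root. -/
def liftVertex (c : Fin 3) : VertexLabel → VertexLabel :=
  Sum.elim (corner [c]) fun q => Sum.inr (q ++ [c])

variable {S : Finset (List (Fin 3))} {c : Fin 3}

theorem liftVertex_injective (c : Fin 3) : Function.Injective (liftVertex c) := by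
  refine (corner_injective [c]).sumElim
    (Sum.inr_injective.comp (List.append_left_injective [c])) fun i q h => ?_
  simpa using length_lt_of_corner_eq_inr h

theorem cornerCount_map_graft {v w : VertexLabel} (h : liftVertex c w = v) :
    cornerCount (S.map (graft c)) v = cornerCount S w := by
  simp only [cornerCount, Finset.sum_map, graft_apply, corner_append_singleton, ← h]
  exact Finset.sum_congr rfl fun p _ => by
    congr! 2 with
    exact (liftVertex_injective c).eq_iff

theorem cornerCount_map_graft_eq_zero {v : VertexLabel} (h : ∀ w, liftVertex c w ≠ v) :
    cornerCount (S.map (graft c)) v = 0 := by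
  simp only [cornerCount, Finset.sum_map, graft_apply, corner_append_singleton]
  exact Finset.sum_eq_zero fun p _ => by
    rw [Finset.card_eq_zero, Finset.filter_eq_empty_iff]
    exact fun i _ => h _

theorem cornerCount_map_graft_inl (i : Fin 3) :
    cornerCount (S.map (graft c)) (Sum.inl i) =
      if i = c then cornerCount S (Sum.inl 0)
      else if i = c + 1 then cornerCount S (Sum.inl 1) else 0 := by
  split_ifs with h h'
  · exact cornerCount_map_graft (by rw [h]; rfl)
  · exact cornerCount_map_graft (by rw [h']; rfl)
  · refine cornerCount_map_graft_eq_zero ?_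
    rintro (j | q)
    · fin_cases j <;> simp [liftVertex, Ne.symm h, Ne.symm h']
    · simp [liftVertex]

theorem cornerCount_nodes (v : VertexLabel) : cornerCount (node t).nodes v =
    (Finset.univ.filter fun i => Sum.inl i = v).card +
      ∑ c, cornerCount ((t c).nodes.map (graft c)) v := by
  simp only [cornerCount, sum_nodes, Finset.sum_map]
  rfl

theorem cornerCount_inl (t : TTree) (i : Fin 3) :
    cornerCount t.nodes (Sum.inl i) = t.arm i := by
  induction t generalizing i with
  | leaf => simp [cornerCount]
  | node t ih =>
    simp only [cornerCount_nodes, cornerCount_map_graft_inl, ih, arm]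
    have hneg : (-1 : Fin 3) = 2 := rfl
    fin_cases i <;> simp [Fin.sum_univ_three, Finset.filter_eq', hneg] <;> ring

theorem cornerCount_root (t : TTree) : cornerCount t.nodes (Sum.inr []) = t.rootCount := by
  cases t with
  | leaf => simp [cornerCount]
  | node t =>
    simp [cornerCount_nodes, cornerCount_map_graft (v := Sum.inr []) (w := Sum.inl 2) rfl,
      cornerCount_inl]

theorem cornerCount_append (i : Fin 3) (q : List (Fin 3)) :
    cornerCount (node t).nodes (Sum.inr (q ++ [i])) = cornerCount (t i).nodes (Sum.inr q) := by
  have hzero (j : Fin 3) (hj : j ≠ i) :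
      cornerCount ((t j).nodes.map (graft j)) (Sum.inr (q ++ [i])) = 0 := by
    refine cornerCount_map_graft_eq_zero ?_
    rintro (k | p)
    · fin_cases k <;> simp [liftVertex]
    · simp [liftVertex, hj]
  rw [cornerCount_nodes, Fintype.sum_eq_single i hzero,
    cornerCount_map_graft (v := Sum.inr (q ++ [i])) (w := Sum.inr q) rfl]
  simp

theorem card_filter_cornerCount (k : ℕ) (t : TTree) :
    (t.nodes.filter fun q => cornerCount t.nodes (Sum.inr q) = k).card = t.hits k := by
  rw [Finset.card_filter]
  induction t with
  | leaf => rfl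
  | node t ih => simp only [sum_nodes, cornerCount_root, cornerCount_append, ih, hits]

end TTree

/-! ### Raney numbers -/

/-- The Raney number: the number of plane forests of `j` trees with `n` nodes in which every node
has `d` children. -/
def raney (d : ℕ) : ℕ → ℕ → ℕ
  | _, 0 => 1
  | 0, _ + 1 => 0
  | j + 1, n + 1 => raney d j (n + 1) + raney d (j + d) n
termination_by j n => (n, j)

@[simp] theorem raney_zero (d j : ℕ) : raney d j 0 = 1 := by rw [raney]

@[simp] theorem raney_zero_succ (d n : ℕ) : raney d 0 (n + 1) = 0 := by rw [raney]

theorem raney_succ_succ (d j n : ℕ) :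
    raney d (j + 1) (n + 1) = raney d j (n + 1) + raney d (j + d) n := by rw [raney]

theorem raney_mul {d : ℕ} (hd : 0 < d) (j n : ℕ) :
    raney d j n * (d * n + j) = j * (d * n + j).choose n := by
  induction n generalizing j with
  | zero => simp
  | succ n ih =>
    induction j with
    | zero => simp
    | succ j ihj =>
      have hn := ih (j + d)
      rw [show d * n + (j + d) = d * (n + 1) + j by ring] at hn
      have hc := Nat.add_one_mul_choose_eq (d * (n + 1) + j) n
      rw [← add_assoc (d * (n + 1)), raney_succ_succ]
      rw [Nat.choose_succ_succ'] at hc ⊢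
      refine mul_left_cancel₀ (show d * (n + 1) + j ≠ 0 by positivity) ?_
      linear_combination (d * (n + 1) + j + 1) * (ihj + hn) + d * hc

theorem raney_mul_real {d : ℕ} (hd : 0 < d) (j n : ℕ) :
    (raney d j n * (d * n + j) : ℝ) = j * (d * n + j).choose n := by
  exact_mod_cast raney_mul hd j n

theorem raney_pos {d j : ℕ} (hd : 0 < d) (hj : 0 < j) (n : ℕ) : 0 < raney d j n := by
  refine pos_of_mul_pos_left ((raney_mul hd j n).symm ▸ ?_) (Nat.zero_le (d * n + j))
  exact mul_pos hj (Nat.choose_pos (le_add_right (Nat.le_mul_of_pos_left n hd)))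

theorem raney_add_mul_choose {d j n M : ℕ} (hd : 0 < d) (hM : M + 1 = d * (n + 1) + j) :
    raney d j (n + 1) + d * M.choose n = (M + 1).choose (n + 1) := by
  have hr := raney_mul hd j (n + 1)
  have hc := Nat.add_one_mul_choose_eq M n
  rw [← hM] at hr
  refine mul_left_cancel₀ M.add_one_ne_zero ?_
  linear_combination hr + d * hc - (M + 1).choose (n + 1) * hM

/-! ### Enumeration of forests -/

namespace TTree

/-- Joins the first three trees of a forest at a new root. -/
def join : List TTree → List TTree
  | a :: b :: c :: l => node ![a, b, c] :: l
  | l => l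

noncomputable instance : DecidableEq TTree := Classical.decEq TTree

/-- The forests of `j` trees with `n` nodes. The first tree of a forest is either a leaf or obtained
by `join`. -/
noncomputable def forests : ℕ → ℕ → Finset (List TTree)
  | 0, 0 => {[]}
  | _ + 1, 0 => ∅
  | 0, j + 1 => (forests 0 j).image (List.cons leaf)
  | n + 1, j + 1 => (forests (n + 1) j).image (List.cons leaf) ∪ (forests n (j + 3)).image join
termination_by n j => (n, j)

theorem exists_eq_cons_cons_cons {j : ℕ} {l : List TTree} (h : l.length = j + 3) :
    ∃ a b c l', l = a :: b :: c :: l' := by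
  match l, h with
  | a :: b :: c :: l', _ => exact ⟨a, b, c, l', rfl⟩

theorem exists_eq_vec (t : Fin 3 → TTree) : ∃ a b c, t = ![a, b, c] :=
  ⟨t 0, t 1, t 2, by ext i; fin_cases i <;> rfl⟩

theorem mem_forests {n j : ℕ} {l : List TTree} :
    l ∈ forests n j ↔ l.length = j ∧ (l.map size).sum = n := by
  induction n, j using forests.induct generalizing l with
  | case1 =>
    simp only [forests, Finset.mem_singleton, List.length_eq_zero_iff]
    exact ⟨fun h => ⟨h, by simp [h]⟩, And.left⟩
  | case2 n =>
    simp only [forests, Finset.notMem_empty, List.length_eq_zero_iff, false_iff]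
    rintro ⟨rfl, h⟩
    simp at h
  | case3 j ih =>
    obtain _ | ⟨_ | t, l⟩ := l <;> simp [forests, ih]
  | case4 n j ih ih' =>
    simp only [forests, Finset.mem_union, Finset.mem_image]
    constructor
    · rintro (⟨l, hl, rfl⟩ | ⟨l, hl, rfl⟩)
      · simpa using ih.1 hl
      · obtain ⟨hlen, hsize⟩ := ih'.1 hl
        obtain ⟨a, b, c, l, rfl⟩ := exists_eq_cons_cons_cons hlen
        simp only [join, List.length_cons, List.map_cons, List.sum_cons, size, Fin.sum_univ_three,
          Matrix.cons_val] at hlen hsize ⊢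
        omega
    · rintro ⟨hlen, hsize⟩
      obtain _ | ⟨_ | t, l⟩ := l
      · simp at hlen
      · exact Or.inl ⟨l, ih.2 ⟨by simpa using hlen, by simpa using hsize⟩, rfl⟩
      · obtain ⟨a, b, c, rfl⟩ := exists_eq_vec t
        refine Or.inr ⟨a :: b :: c :: l, ih'.2 ?_, rfl⟩
        simp only [List.length_cons, List.map_cons, List.sum_cons, size, Fin.sum_univ_three,
          Matrix.cons_val] at hlen hsize ⊢
        omega

/-! ### Sums over forests -/

section Sums

variable {α : Type*} [AddCommMonoid α]

theorem sum_forests_zero (j : ℕ) (g : List TTree → α) :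
    ∑ l ∈ forests 0 j, g l = g (List.replicate j leaf) := by
  induction j generalizing g with
  | zero => simp [forests]
  | succ j ih => simp [forests, Finset.sum_image, ih, List.replicate_succ]

@[simp] theorem forests_succ_zero (n : ℕ) : forests (n + 1) 0 = ∅ := by rw [forests]

theorem join_injOn (n j : ℕ) : Set.InjOn join (forests n (j + 3) : Set (List TTree)) := by
  intro l hl l' hl' h
  obtain ⟨a, b, c, l, rfl⟩ := exists_eq_cons_cons_cons (mem_forests.1 hl).1
  obtain ⟨a', b', c', l', rfl⟩ := exists_eq_cons_cons_cons (mem_forests.1 hl').1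
  simpa [join, and_assoc] using h

theorem sum_forests_succ (n j : ℕ) (g : List TTree → α) :
    ∑ l ∈ forests (n + 1) (j + 1), g l =
      ∑ l ∈ forests (n + 1) j, g (leaf :: l) + ∑ l ∈ forests n (j + 3), g (join l) := by
  rw [forests, Finset.sum_union, Finset.sum_image List.cons_injective.injOn,
    Finset.sum_image (join_injOn n j)]
  rw [Finset.disjoint_left]
  rintro _ hl hl'
  obtain ⟨l, -, rfl⟩ := Finset.mem_image.1 hl
  obtain ⟨l', hl', h⟩ := Finset.mem_image.1 hl'
  obtain ⟨a, b, c, l', rfl⟩ := exists_eq_cons_cons_cons (mem_forests.1 hl').1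
  simp [join] at h

theorem sum_forests_congr {n j : ℕ} {g h : List TTree → α}
    (e : ∀ a b c l, g (a :: b :: c :: l) = h (a :: b :: c :: l)) :
    ∑ l ∈ forests n (j + 3), g l = ∑ l ∈ forests n (j + 3), h l := by
  refine Finset.sum_congr rfl fun l hl => ?_
  obtain ⟨a, b, c, l, rfl⟩ := exists_eq_cons_cons_cons (mem_forests.1 hl).1
  exact e a b c l

end Sums

theorem card_forests (n j : ℕ) : (forests n j).card = raney 3 j n := by
  induction n, j using forests.induct with
  | case1 => simp [forests]
  | case2 n => simp
  | case3 j _ => rw [Finset.card_eq_sum_ones, sum_forests_zero, raney_zero]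
  | case4 n j ih ih' =>
    rw [raney_succ_succ, ← ih, ← ih']
    simp only [Finset.card_eq_sum_ones, sum_forests_succ]

/-! ### Enumeration of forests by the lengths of their arms -/

/-- The sum of `arm t c` over the trees `t` of a forest with a mark `some c`. -/
def totalArm (ms : List (Option (Fin 3))) (l : List TTree) : ℕ :=
  (List.zipWith (fun m t => m.elim 0 t.arm) ms l).sum

/-- The corners of the three subtrees of the root that are glued to the corner `c`. -/
def childMarks : Fin 3 → List (Option (Fin 3))
  | 0 => [some 0, none, some 1]
  | 1 => [some 1, some 0, none]
  | 2 => [none, some 1, some 0]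

theorem length_childMarks_append (c : Fin 3) (ms : List (Option (Fin 3))) :
    (childMarks c ++ ms).length = ms.length + 3 := by
  fin_cases c <;> simp [childMarks]

theorem countP_isSome_childMarks_append (c : Fin 3) (ms : List (Option (Fin 3))) :
    (childMarks c ++ ms).countP Option.isSome = ms.countP Option.isSome + 2 := by
  fin_cases c <;> simp [childMarks]

theorem countP_isNone_childMarks_append (c : Fin 3) (ms : List (Option (Fin 3))) :
    (childMarks c ++ ms).countP Option.isNone = ms.countP Option.isNone + 1 := by
  fin_cases c <;> simp [childMarks]

@[simp] theorem totalArm_nil_right (ms : List (Option (Fin 3))) : totalArm ms [] = 0 := by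
  simp [totalArm]

@[simp] theorem totalArm_nil_left (l : List TTree) : totalArm [] l = 0 := by
  simp [totalArm]

@[simp] theorem totalArm_none_cons (ms : List (Option (Fin 3))) (t : TTree) (l : List TTree) :
    totalArm (none :: ms) (t :: l) = totalArm ms l := by
  simp [totalArm]

@[simp] theorem totalArm_some_cons (i : Fin 3) (ms : List (Option (Fin 3))) (t : TTree)
    (l : List TTree) : totalArm (some i :: ms) (t :: l) = t.arm i + totalArm ms l := by
  simp [totalArm]

theorem totalArm_some_node (i : Fin 3) (ms : List (Option (Fin 3))) (a b c : TTree)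
    (l : List TTree) : totalArm (some i :: ms) (node ![a, b, c] :: l) =
      totalArm (childMarks i ++ ms) (a :: b :: c :: l) + 1 := by
  have hneg : (-1 : Fin 3) = 2 := rfl
  fin_cases i <;> simp [childMarks, hneg] <;> ring

theorem arm_le_size (t : TTree) (i : Fin 3) : t.arm i ≤ t.size := by
  induction t generalizing i with
  | leaf => simp
  | node t ih =>
    have hne : i ≠ i - 1 := by fin_cases i <;> decide
    have hsum := Finset.sum_le_univ_sum_of_nonneg (f := fun j => (t j).size)
      (s := {i, i - 1}) fun _ => Nat.zero_le _
    rw [Finset.sum_pair hne] at hsum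
    simp only [arm, size]
    linarith [ih i 0, ih (i - 1) 1]

theorem totalArm_le_size (ms : List (Option (Fin 3))) (l : List TTree) :
    totalArm ms l ≤ (l.map size).sum := by
  induction l generalizing ms with
  | nil => simp
  | cons t l ih =>
    rcases ms with _ | ⟨_ | c, ms⟩
    · simp
    · simpa using le_add_left (ih ms)
    · simpa using add_le_add (arm_le_size t c) (ih ms)

/-- The number of forests with `n` nodes whose marked arms have total length `k`. -/
noncomputable def armCount (n : ℕ) (ms : List (Option (Fin 3))) (k : ℕ) : ℕ :=
  ((forests n ms.length).filter fun l => totalArm ms l = k).card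

theorem armCount_eq_sum (n : ℕ) (ms : List (Option (Fin 3))) (k : ℕ) :
    armCount n ms k = ∑ l ∈ forests n ms.length, if totalArm ms l = k then 1 else 0 := by
  rw [armCount, Finset.card_filter]

theorem armCount_eq_zero {n k : ℕ} (h : n < k) (ms : List (Option (Fin 3))) :
    armCount n ms k = 0 := by
  rw [armCount, Finset.card_eq_zero, Finset.filter_eq_empty_iff]
  intro l hl
  have := totalArm_le_size ms l
  rw [(mem_forests.1 hl).2] at this
  omega

theorem armCount_zero_zero (ms : List (Option (Fin 3))) : armCount 0 ms 0 = 1 := by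
  rw [armCount_eq_sum, sum_forests_zero, if_pos]
  simpa using totalArm_le_size ms (List.replicate ms.length leaf)

theorem armCount_succ_nil (n k : ℕ) : armCount (n + 1) [] k = 0 := by
  simp [armCount]

theorem armCount_succ_none_cons (n : ℕ) (ms : List (Option (Fin 3))) (k : ℕ) :
    armCount (n + 1) (none :: ms) k =
      armCount (n + 1) ms k + armCount n (none :: none :: none :: ms) k := by
  simp only [armCount_eq_sum, List.length_cons, sum_forests_succ, totalArm_none_cons]
  congr 1
  exact sum_forests_congr fun a b c l => by simp only [join, totalArm_none_cons]

theorem armCount_succ_some_cons_zero (n : ℕ) (c : Fin 3) (ms : List (Option (Fin 3))) :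
    armCount (n + 1) (some c :: ms) 0 = armCount (n + 1) ms 0 := by
  simp only [armCount_eq_sum, List.length_cons, sum_forests_succ, totalArm_some_cons, arm, zero_add]
  rw [sum_forests_congr (h := fun _ => 0) fun a b c l => by simp [join]]
  simp

theorem armCount_succ_some_cons_succ (n : ℕ) (c : Fin 3) (ms : List (Option (Fin 3))) (k : ℕ) :
    armCount (n + 1) (some c :: ms) (k + 1) =
      armCount (n + 1) ms (k + 1) + armCount n (childMarks c ++ ms) k := by
  simp only [armCount_eq_sum, List.length_cons, sum_forests_succ, length_childMarks_append,
    totalArm_some_cons, arm, zero_add]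
  congr 1
  exact sum_forests_congr fun a b d l => by
    simp only [join, totalArm_some_node, Nat.add_right_cancel_iff]

/-- The nodes on the marked arms form a binary forest; the `k + countP isNone` trees hanging off it
are arbitrary. -/
theorem armCount_add (n k : ℕ) (ms : List (Option (Fin 3))) :
    armCount (n + k) ms k =
      raney 2 (ms.countP Option.isSome) k * raney 3 (k + ms.countP Option.isNone) n := by
  induction hN : n + k generalizing n k ms with
  | zero =>
    obtain ⟨rfl, rfl⟩ : n = 0 ∧ k = 0 := by omega
    simp [armCount_zero_zero]
  | succ N ih =>
    induction ms with
    | nil =>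
      rcases k with _ | k
      · obtain rfl : n = N + 1 := by omega
        simp [armCount_succ_nil]
      · simp [armCount_succ_nil]
    | cons m ms ihms =>
      rcases m with _ | c
      · rw [armCount_succ_none_cons, ihms]
        rcases n with _ | n
        · simp [armCount_eq_zero (show N < k by omega)]
        · rw [ih n k _ (by omega)]
          simp [← add_assoc, raney_succ_succ, mul_add]
      · rcases k with _ | k
        · rw [armCount_succ_some_cons_zero, ihms]
          simp
        · rw [armCount_succ_some_cons_succ, ihms, ih n k _ (by omega),
            countP_isSome_childMarks_append, countP_isNone_childMarks_append]
          simp [raney_succ_succ, add_mul, add_assoc, add_comm 1]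

/-! ### Enumeration of forests by the degrees of their vertices -/

@[simp] theorem totalArm_replicate_none (j : ℕ) (l : List TTree) :
    totalArm (List.replicate j none) l = 0 := by
  induction l generalizing j with
  | nil => simp
  | cons t l ih => cases j <;> simp [List.replicate_succ, ih]

theorem rootCount_node_cons (a b c : TTree) :
    (node ![a, b, c]).rootCount = a.arm 2 + (b.arm 2 + c.arm 2) := by
  simp [Fin.sum_univ_three, add_assoc]

theorem card_filter_rootCount_join (m j k : ℕ) :
    ((forests (m + k) (j + 3)).filter fun l => ((join l).headD leaf).rootCount = k).card =
      raney 2 3 k * raney 3 (k + j) m := by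
  have hcount := armCount_add m k (some 2 :: some 2 :: some 2 :: List.replicate j none)
  rw [armCount_eq_sum] at hcount
  simp only [List.length_cons, List.length_replicate] at hcount
  rw [Finset.card_filter, sum_forests_congr fun a b c l => ?_, hcount]
  · simp [List.countP_replicate]
  · simp only [join, List.headD_cons, rootCount_node_cons, totalArm_some_cons,
      totalArm_replicate_none, add_zero]

theorem rootCount_node_lt_size (t : Fin 3 → TTree) : (node t).rootCount < (node t).size :=
  Nat.lt_succ_of_le <| Finset.sum_le_sum fun i _ => arm_le_size (t i) 2

theorem hits_eq_zero {k : ℕ} {t : TTree} (h : t.size ≤ k) : t.hits k = 0 := by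
  induction t with
  | leaf => rfl
  | node t ih =>
    have hroot := (rootCount_node_lt_size t).trans_le h
    have hchild (i : Fin 3) : (t i).hits k = 0 := by
      refine ih i (le_trans ?_ h)
      exact (Finset.single_le_sum (fun j _ => Nat.zero_le (t j).size) (Finset.mem_univ i)).trans
        (Nat.le_succ _)
    simp only [hits, if_neg hroot.ne, hchild, Finset.sum_const_zero, add_zero]

/-- The number of vertices of degree `k + 3` inserted in the forests of `j` trees with `n` nodes. -/
noncomputable def hitCount (n j k : ℕ) : ℕ :=
  ∑ l ∈ forests n j, (l.map (hits k)).sum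

@[simp] theorem hitCount_self (j k : ℕ) : hitCount k j k = 0 := by
  refine Finset.sum_eq_zero fun l hl => List.sum_eq_zero fun x hx => ?_
  obtain ⟨t, ht, rfl⟩ := List.mem_map.1 hx
  have hle := List.le_sum_of_mem (List.mem_map_of_mem (f := size) ht)
  rw [(mem_forests.1 hl).2] at hle
  exact hits_eq_zero hle

theorem hitCount_add_one_zero (n k : ℕ) : hitCount (n + 1) 0 k = 0 := by
  simp [hitCount]

theorem hitCount_add_one_add_one (m j k : ℕ) :
    hitCount (m + k + 1) (j + 1) k =
      hitCount (m + k + 1) j k +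
        (raney 2 3 k * raney 3 (k + j) m + hitCount (m + k) (j + 3) k) := by
  rw [hitCount, sum_forests_succ, ← card_filter_rootCount_join, Finset.card_filter, hitCount,
    hitCount, ← Finset.sum_add_distrib]
  congr 1
  · simp
  · refine sum_forests_congr fun a b c l => ?_
    simp [join, Fin.sum_univ_three, add_assoc]

theorem hitCount_add_one (m j k : ℕ) :
    hitCount (m + k + 1) j k = j * (raney 2 3 k * (3 * m + k + j - 1).choose m) := by
  induction m generalizing j with
  | zero =>
    induction j with
    | zero => simp [hitCount_add_one_zero]
    | succ j ih =>
      rw [hitCount_add_one_add_one, ih, zero_add, hitCount_self]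
      simp [add_mul]
  | succ m ih =>
    induction j with
    | zero => simp [hitCount_add_one_zero]
    | succ j ihj =>
      have hr := raney_add_mul_choose (d := 3) (j := k + j) (n := m) (M := 3 * m + k + j + 2)
        three_pos (by ring)
      rw [hitCount_add_one_add_one, ihj, add_right_comm m, ih,
        show 3 * (m + 1) + k + j - 1 = 3 * m + k + j + 2 by omega,
        show 3 * m + k + (j + 3) - 1 = 3 * m + k + j + 2 by omega,
        show 3 * (m + 1) + k + (j + 1) - 1 = 3 * m + k + j + 2 + 1 by omega]
      rw [Nat.choose_succ_succ' (3 * m + k + j + 2)] at hr ⊢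
      linear_combination raney 2 3 k * hr

end TTree

/-! ### The laws of the degrees -/

theorem bind_uniformOfFintype_apply {α : Type*} [Fintype α] [Nonempty α] (g : α → PMF ℕ) (k : ℕ) :
    ((PMF.uniformOfFintype α).bind g k).toReal = (∑ a, (g a k).toReal) / Fintype.card α := by
  rw [PMF.bind_apply, tsum_fintype, ENNReal.toReal_sum]
  · simp [← Finset.mul_sum, div_eq_inv_mul]
  · simp [ENNReal.mul_eq_top, PMF.apply_ne_top]

theorem map_uniformOfFintype_apply {α : Type*} [Fintype α] [Nonempty α] (g : α → ℕ) (k : ℕ) :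
    ((PMF.uniformOfFintype α).map g k).toReal =
      ((Finset.univ.filter fun a => g a = k).card : ℝ) / Fintype.card α := by
  rw [← PMF.bind_pure_comp, bind_uniformOfFintype_apply]
  simp [PMF.pure_apply, apply_ite, eq_comm (a := k)]

namespace StackTriangulation

open RootedMap StackCode TTree

theorem exists_nodes_eq_tree {n : ℕ} (t : StackTriangulation (n + 1)) :
    ∃ s : TTree, s.nodes = t.tree :=
  exists_nodes_eq t.tree t.isLabelling.tree

/-- The ternary tree that encodes a stack-triangulation. -/
noncomputable def toTTree {n : ℕ} (t : StackTriangulation (n + 1)) : TTree :=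
  t.exists_nodes_eq_tree.choose

theorem nodes_toTTree {n : ℕ} (t : StackTriangulation (n + 1)) : t.toTTree.nodes = t.tree :=
  t.exists_nodes_eq_tree.choose_spec

theorem size_toTTree {n : ℕ} (t : StackTriangulation (n + 1)) : t.toTTree.size = n := by
  have h := t.card_tree
  rw [← nodes_toTTree, card_nodes] at h
  omega

theorem toTTree_injective (n : ℕ) :
    Function.Injective (toTTree : StackTriangulation (n + 1) → TTree) := fun t t' h =>
  tree_injective <| by rw [← nodes_toTTree, ← nodes_toTTree, h]

theorem exists_toTTree_eq (s : TTree) : ∃ t : StackTriangulation (s.size + 1), t.toTTree = s := by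
  obtain ⟨t, ht⟩ := exists_tree_eq (isTree_nodes s) (card_nodes s)
  exact ⟨t, nodes_injective (by rw [nodes_toTTree, ht])⟩

theorem sum_toTTree (n : ℕ) (g : TTree → ℕ) :
    ∑ t : StackTriangulation (n + 1), g t.toTTree = ∑ l ∈ forests n 1, g (l.headD leaf) := by
  refine Finset.sum_bij (fun t _ => [t.toTTree]) (fun t _ => ?_) (fun t _ t' _ h => ?_)
    (fun l hl => ?_) (fun t _ => ?_)
  · simp [mem_forests, size_toTTree]
  · exact toTTree_injective n (List.cons.inj h).1
  · obtain ⟨hlen, hsize⟩ := mem_forests.1 hl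
    obtain ⟨s, rfl⟩ := List.length_eq_one_iff.1 hlen
    obtain rfl : s.size = n := by simpa using hsize
    obtain ⟨t, ht⟩ := exists_toTTree_eq s
    exact ⟨t, Finset.mem_univ t, congrArg (fun s => [s]) ht⟩
  · simp

theorem card_eq (n : ℕ) : Fintype.card (StackTriangulation (n + 1)) = raney 3 1 n := by
  rw [Fintype.card_eq_sum_ones, sum_toTTree n fun _ => 1, ← card_forests, Finset.card_eq_sum_ones]

theorem card_filter_degree_eq (m k : ℕ) {u : ∀ t : StackTriangulation (m + k + 2), t.rep.Vertex}
    (hu : ∀ t : StackTriangulation (m + k + 2), t.rep.IsFirstInserted (u t)) :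
    (Finset.univ.filter fun t : StackTriangulation (m + k + 2) =>
      t.rep.degree (u t) = k + 3).card = raney 2 3 k * raney 3 k m := by
  have hdeg (t : StackTriangulation (m + k + 2)) :
      t.rep.degree (u t) = t.toTTree.rootCount + 3 := by
    rw [(hu t).degree_eq t.isLabelling, ← nodes_toTTree, cornerCount_root, add_comm]
  simp only [hdeg, Nat.add_right_cancel_iff]
  rw [Finset.card_filter, sum_toTTree _ fun s => if s.rootCount = k then 1 else 0,
    sum_forests_succ, forests_succ_zero, Finset.sum_empty, zero_add, ← Finset.card_filter]
  exact card_filter_rootCount_join m 0 k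

theorem card_internalVertex {n : ℕ} (t : StackTriangulation (n + 1)) :
    Fintype.card t.InternalVertex = n := by
  obtain ⟨e, -⟩ := t.exists_vertexEquiv
  rw [← Fintype.card_congr e, Fintype.card_coe]
  exact Nat.succ_injective t.card_tree

theorem card_filter_internalDegree_eq {n : ℕ} (t : StackTriangulation (n + 1)) (k : ℕ) :
    (Finset.univ.filter fun v : t.InternalVertex => t.rep.degree v.1 = k + 3).card =
      t.toTTree.hits k := by
  obtain ⟨e, he⟩ := t.exists_vertexEquiv
  rw [Finset.card_filter, ← e.sum_comp, ← card_filter_cornerCount, nodes_toTTree,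
    Finset.card_filter, ← Finset.sum_coe_sort t.tree]
  simp only [he, add_comm 3, Nat.add_right_cancel_iff]

theorem degreeLaw_apply (m k : ℕ) {u : ∀ t : StackTriangulation (m + k + 2), t.rep.Vertex}
    (hu : ∀ t : StackTriangulation (m + k + 2), t.rep.IsFirstInserted (u t)) :
    (degreeLaw (m + k) u (k + 3)).toReal =
      (raney 2 3 k * raney 3 k m : ℝ) / raney 3 1 (m + k + 1) := by
  rw [degreeLaw, map_uniformOfFintype_apply, card_filter_degree_eq m k hu, card_eq]
  push_cast
  rfl

theorem sum_hits_toTTree (n k : ℕ) :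
    ∑ t : StackTriangulation (n + 1), t.toTTree.hits k = hitCount n 1 k := by
  rw [sum_toTTree]
  refine Finset.sum_congr rfl fun l hl => ?_
  obtain ⟨s, rfl⟩ := List.length_eq_one_iff.1 (mem_forests.1 hl).1
  simp

theorem internalDegreeLaw_apply (m k : ℕ) :
    (internalDegreeLaw (m + k) (k + 3)).toReal =
      (raney 2 3 k * (3 * m + k).choose m : ℝ) / (raney 3 1 (m + k + 1) * (m + k + 1)) := by
  rw [internalDegreeLaw, bind_uniformOfFintype_apply, card_eq]
  simp only [map_uniformOfFintype_apply, card_filter_internalDegree_eq, card_internalVertex]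
  rw [← Finset.sum_div, ← Nat.cast_sum, sum_hits_toTTree, hitCount_add_one, div_div,
    mul_comm (raney 3 1 _ : ℝ)]
  simp

end StackTriangulation

/-! ### Convergence in law -/

theorem tendsto_law_of_le_liminf {p : ℕ → PMF ℕ} {q : PMF ℕ}
    (h : ∀ k, q k ≤ liminf (fun n => p n k) atTop) :
    Tendsto (fun n => (p n).law) atTop (𝓝 q.law) := by
  refine tendsto_of_forall_isOpen_le_liminf' fun G _ => ?_
  have hG (r : PMF ℕ) : (r.law : Measure ℕ) G = ∫⁻ k, G.indicator r k ∂Measure.count := by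
    rw [lintegral_count]
    exact r.toMeasure_apply (MeasurableSet.of_discrete)
  simp only [hG]
  refine (lintegral_mono fun k => ?_).trans
    (lintegral_liminf_le fun n => measurable_of_countable _)
  by_cases hk : k ∈ G
  · simpa [hk] using h k
  · simp [hk]

theorem exists_pmf_add_apply {f : ℕ → ℝ} (hf : ∀ k, 0 ≤ f k) (hs : HasSum f 1) (d : ℕ) :
    ∃ q : PMF ℕ, (∀ k, q (k + d) = ENNReal.ofReal (f k)) ∧ ∀ k < d, q k = 0 := by
  have hsum : HasSum (fun k => ENNReal.ofReal (f k)) 1 := by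
    rw [ENNReal.summable.hasSum_iff, ← ENNReal.ofReal_tsum_of_nonneg hf hs.summable, hs.tsum_eq,
      ENNReal.ofReal_one]
  let p : PMF ℕ := ⟨fun k => ENNReal.ofReal (f k), hsum⟩
  refine ⟨p.map (· + d), fun k => ?_, fun k hk => ?_⟩
  · simpa [PMF.map_apply] using show p k = ENNReal.ofReal (f k) from rfl
  · rw [PMF.map_apply, ENNReal.tsum_eq_zero]
    exact fun b => if_neg (by omega)

/-- No mass escapes to infinity, because the limits of the point masses sum to `1`. -/
theorem exists_pmf_tendsto_law {f : ℕ → ℝ} (hf : ∀ k, 0 ≤ f k) (hs : HasSum f 1) (d : ℕ) :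
    ∃ q : PMF ℕ, (∀ k, (q (k + d)).toReal = f k) ∧ ∀ p : ℕ → PMF ℕ,
      (∀ k, Tendsto (fun n => (p n (k + d)).toReal) atTop (𝓝 (f k))) →
      Tendsto (fun n => (p n).law) atTop (𝓝 q.law) := by
  obtain ⟨q, hq, hq0⟩ := exists_pmf_add_apply hf hs d
  refine ⟨q, fun k => by rw [hq, ENNReal.toReal_ofReal (hf k)], fun p hp => ?_⟩
  refine tendsto_law_of_le_liminf fun k => ?_
  obtain hk | ⟨k, rfl⟩ := (lt_or_ge k d).imp_right Nat.exists_eq_add_of_le'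
  · exact (hq0 k hk).trans_le zero_le
  · have hlim := ENNReal.tendsto_ofReal (hp k)
    simp only [ENNReal.ofReal_toReal (PMF.apply_ne_top _ _)] at hlim
    rw [hq, hlim.liminf_eq]

/-! ### Generating functions -/

/-- The solutions of the recurrence of the ballot numbers. Besides `raney 2`, the array of the
binomial coefficients `(2 * k + j).choose k` is one. -/
structure IsBallotArray (f : ℕ → ℕ → ℕ) : Prop where
  zero : ∀ j, f (j + 1) 0 = f j 0
  succ : ∀ j k, f (j + 1) (k + 1) = f j (k + 1) + f (j + 2) k

theorem isBallotArray_raney : IsBallotArray (raney 2) where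
  zero j := by simp
  succ j k := raney_succ_succ 2 j k

theorem isBallotArray_choose : IsBallotArray fun j k => (2 * k + j).choose k where
  zero j := by simp
  succ j k := by
    rw [show 2 * (k + 1) + (j + 1) = 2 * (k + 1) + j + 1 by ring, Nat.choose_succ_succ', add_comm]
    congr 2
    ring

namespace IsBallotArray

variable {f : ℕ → ℕ → ℕ} {x a C : ℝ}

theorem sum_range_succ (h : IsBallotArray f) (x : ℝ) (n j : ℕ) :
    ∑ k ∈ Finset.range (n + 1), (f (j + 1) k : ℝ) * x ^ k =
      ∑ k ∈ Finset.range (n + 1), (f j k : ℝ) * x ^ k +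
        x * ∑ k ∈ Finset.range n, (f (j + 2) k : ℝ) * x ^ k := by
  simp only [Finset.sum_range_succ', h.zero, h.succ, Nat.cast_add, add_mul, Finset.sum_add_distrib,
    Finset.mul_sum, pow_succ', mul_left_comm x]
  ring

/-- The bound propagates in `j` because `a` is a root of `t = 1 + x * t ^ 2`. -/
theorem sum_range_le (h : IsBallotArray f) (ha : 1 ≤ a) (hx : x * a ^ 2 = a - 1) (hC : 0 ≤ C)
    (h0 : ∀ n, ∑ k ∈ Finset.range n, (f 1 k : ℝ) * x ^ k ≤ C * a →
      ∑ k ∈ Finset.range (n + 1), (f 0 k : ℝ) * x ^ k ≤ C) (n j : ℕ) :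
    ∑ k ∈ Finset.range n, (f j k : ℝ) * x ^ k ≤ C * a ^ j := by
  have hx0 : 0 ≤ x := nonneg_of_mul_nonneg_left (hx ▸ sub_nonneg.2 ha) (by positivity)
  induction n generalizing j with
  | zero => simpa using by positivity
  | succ n ih =>
    induction j with
    | zero => simpa using h0 n (by simpa using ih 1)
    | succ j ihj =>
      calc ∑ k ∈ Finset.range (n + 1), (f (j + 1) k : ℝ) * x ^ k
          ≤ C * a ^ j + x * (C * a ^ (j + 2)) := by
            rw [h.sum_range_succ]
            gcongr
            exact ih (j + 2)
        _ = C * a ^ (j + 1) := by linear_combination C * a ^ j * hx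

theorem tsum_succ (h : IsBallotArray f) (hs : ∀ j, Summable fun k => (f j k : ℝ) * x ^ k) (j : ℕ) :
    ∑' k, (f (j + 1) k : ℝ) * x ^ k =
      ∑' k, (f j k : ℝ) * x ^ k + x * ∑' k, (f (j + 2) k : ℝ) * x ^ k := by
  have hlim (j : ℕ) := (hs j).hasSum.tendsto_sum_nat
  refine tendsto_nhds_unique ((hlim (j + 1)).comp (tendsto_add_atTop_nat 1)) ?_
  refine (((hlim j).comp (tendsto_add_atTop_nat 1)).add ((hlim (j + 2)).const_mul x)).congr ?_
  exact fun n => (h.sum_range_succ x n j).symm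

end IsBallotArray

/-- The second root of the characteristic equation is `a / (a - 1)`, whose powers grow too fast. -/
theorem succ_eq_mul_of_linear_recurrence {F : ℕ → ℝ} {x a C : ℝ} (ha : 1 ≤ a) (ha2 : a < 2)
    (hx : x * a ^ 2 = a - 1) (hF : ∀ j, F (j + 1) = F j + x * F (j + 2))
    (hb : ∀ j, |F j| ≤ C * a ^ j) (j : ℕ) : F (j + 1) = a * F j := by
  have ha0 : 0 < a := by positivity
  have ha1 : 0 ≤ a - 1 := sub_nonneg.2 ha
  let D (j : ℕ) : ℝ := F (j + 1) - a * F j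
  have hD_succ (j : ℕ) : a * D j = (a - 1) * D (j + 1) := by
    linear_combination a ^ 2 * hF j + F (j + 2) * hx
  have hD_add (n : ℕ) : a ^ n * D j = (a - 1) ^ n * D (j + n) := by
    induction n with
    | zero => simp
    | succ n ih => linear_combination a * ih + (a - 1) ^ n * hD_succ (j + n)
  have hD_abs (i : ℕ) : |D i| ≤ 2 * C * a ^ (i + 1) :=
    calc |D i| ≤ |F (i + 1)| + |a * F i| := abs_sub _ _
      _ = |F (i + 1)| + a * |F i| := by rw [abs_mul, abs_of_pos ha0]
      _ ≤ C * a ^ (i + 1) + a * (C * a ^ i) := by gcongr <;> apply hb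
      _ = 2 * C * a ^ (i + 1) := by ring
  have hD_le (n : ℕ) : |D j| ≤ (a - 1) ^ n * (2 * C * a ^ (j + 1)) := by
    refine le_of_mul_le_mul_left ?_ (pow_pos ha0 n)
    calc a ^ n * |D j| = (a - 1) ^ n * |D (j + n)| := by
          rw [← abs_of_pos (pow_pos ha0 n), ← abs_mul, hD_add, abs_mul,
            abs_of_nonneg (pow_nonneg ha1 n)]
      _ ≤ (a - 1) ^ n * (2 * C * a ^ (j + n + 1)) := by gcongr; exact hD_abs (j + n)
      _ = a ^ n * ((a - 1) ^ n * (2 * C * a ^ (j + 1))) := by ring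
  have hlim := (tendsto_pow_atTop_nhds_zero_of_lt_one ha1 (by linarith)).mul_const
    (2 * C * a ^ (j + 1))
  rw [zero_mul] at hlim
  exact sub_eq_zero.1 (abs_nonpos_iff.1 (ge_of_tendsto' hlim hD_le))

theorem IsBallotArray.hasSum {f : ℕ → ℕ → ℕ} {x a C : ℝ} (h : IsBallotArray f) (ha : 1 ≤ a)
    (ha2 : a < 2) (hx : x * a ^ 2 = a - 1)
    (hb : ∀ n j, ∑ k ∈ Finset.range n, (f j k : ℝ) * x ^ k ≤ C * a ^ j) (j : ℕ) :
    HasSum (fun k => (f j k : ℝ) * x ^ k) ((∑' k, (f 0 k : ℝ) * x ^ k) * a ^ j) := by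
  have hx0 : 0 ≤ x := nonneg_of_mul_nonneg_left (hx ▸ sub_nonneg.2 ha) (by positivity)
  have hpos (j k : ℕ) : 0 ≤ (f j k : ℝ) * x ^ k := by positivity
  have hs (j : ℕ) : Summable fun k => (f j k : ℝ) * x ^ k :=
    summable_of_sum_range_le (hpos j) fun n => hb n j
  have habs (j : ℕ) : |∑' k, (f j k : ℝ) * x ^ k| ≤ C * a ^ j := by
    rw [abs_of_nonneg (tsum_nonneg (hpos j))]
    exact Real.tsum_le_of_sum_range_le (hpos j) fun n => hb n j
  have hstep := succ_eq_mul_of_linear_recurrence ha ha2 hx (h.tsum_succ hs) habs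
  convert (hs j).hasSum
  induction j with
  | zero => simp
  | succ j ih => rw [hstep, ← ih]; ring

theorem hasSum_raney_two {x a : ℝ} (ha : 1 ≤ a) (ha2 : a < 2) (hx : x * a ^ 2 = a - 1) (j : ℕ) :
    HasSum (fun k => (raney 2 j k : ℝ) * x ^ k) (a ^ j) := by
  have hsum (n : ℕ) : ∑ k ∈ Finset.range (n + 1), (raney 2 0 k : ℝ) * x ^ k = 1 := by
    simp [Finset.sum_range_succ']
  have hzero : ∑' k, (raney 2 0 k : ℝ) * x ^ k = 1 := by
    rw [tsum_eq_single 0 fun k hk => ?_]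
    · simp
    · obtain ⟨k, rfl⟩ := Nat.exists_eq_add_one_of_ne_zero hk
      simp
  have h := isBallotArray_raney.hasSum ha ha2 hx (C := 1)
    (isBallotArray_raney.sum_range_le ha hx zero_le_one fun n _ => (hsum n).le) j
  rwa [hzero, one_mul] at h

theorem sum_range_succ_choose_two_mul (x : ℝ) (n : ℕ) :
    ∑ k ∈ Finset.range (n + 1), ((2 * k + 0).choose k : ℝ) * x ^ k =
      1 + 2 * x * ∑ k ∈ Finset.range n, ((2 * k + 1).choose k : ℝ) * x ^ k := by
  have hchoose (k : ℕ) : (2 * (k + 1) + 0).choose (k + 1) = 2 * (2 * k + 1).choose k := by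
    rw [show 2 * (k + 1) + 0 = 2 * k + 1 + 1 by ring, Nat.choose_succ_succ', Nat.choose_symm_half]
    ring
  simp only [Finset.sum_range_succ', hchoose, Finset.mul_sum]
  simp [pow_succ', mul_assoc, mul_left_comm x, add_comm]

theorem hasSum_choose_two_mul_add {x a : ℝ} (ha : 1 ≤ a) (ha2 : a < 2) (hx : x * a ^ 2 = a - 1)
    (j : ℕ) : HasSum (fun k => ((2 * k + j).choose k : ℝ) * x ^ k) (a / (2 - a) * a ^ j) := by
  have ha0 : 0 < 2 - a := sub_pos.2 ha2
  have hC : 1 + 2 * x * (a / (2 - a) * a) = a / (2 - a) := by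
    field_simp
    linear_combination 2 * hx
  have hx0 : 0 ≤ x := nonneg_of_mul_nonneg_left (hx ▸ sub_nonneg.2 ha) (by positivity)
  have h := isBallotArray_choose.hasSum ha ha2 hx
    (isBallotArray_choose.sum_range_le ha hx (C := a / (2 - a)) (by positivity) fun n hn => by
      rw [sum_range_succ_choose_two_mul, ← hC]
      gcongr)
  have hzero := tendsto_nhds_unique ((h 0).tendsto_sum_nat.comp (tendsto_add_atTop_nat 1))
    (((h 1).tendsto_sum_nat.const_mul (2 * x)).const_add 1 |>.congr fun n =>
      (sum_range_succ_choose_two_mul x n).symm)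
  set F := ∑' k, ((2 * k + 0).choose k : ℝ) * x ^ k
  have hF : F = a / (2 - a) := by
    rw [eq_div_iff ha0.ne']
    linear_combination a * hzero + 2 * F * hx
  rw [← hF]
  exact h j

/-! ### Ratios of binomial coefficients -/

theorem tendsto_choose_div_choose_add {e : ℕ} (he : 0 < e) (c : ℕ) :
    Tendsto (fun m : ℕ => (((e + 1) * m + c).choose m : ℝ) / ((e + 1) * m).choose m) atTop
      (𝓝 (((e + 1) / e) ^ c)) := by
  induction c with
  | zero =>
    have hne (m : ℕ) : (((e + 1) * m).choose m : ℝ) ≠ 0 :=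
      Nat.cast_ne_zero.2 (Nat.choose_pos (Nat.le_mul_of_pos_left m e.succ_pos)).ne'
    simp only [add_zero, div_self (hne _), pow_zero, tendsto_const_nhds]
  | succ c ih =>
    rw [pow_succ]
    refine (ih.mul (tendsto_add_mul_div_add_mul_atTop_nhds (c + 1 : ℝ) (c + 1) (e + 1)
      (d := e) (by positivity))).congr fun m => ?_
    have h := Nat.choose_mul_succ_eq ((e + 1) * m + c) m
    rw [show (e + 1) * m + c + 1 - m = e * m + c + 1 by rw [add_one_mul]; omega] at h
    replace h := congrArg (Nat.cast : ℕ → ℝ) h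
    push_cast at h
    have hpos : (c + 1 + e * m : ℝ) ≠ 0 := by positivity
    symm
    rw [div_mul_div_comm, ← mul_div_mul_right _ _ hpos, ← add_assoc]
    congr 1
    linear_combination -h

theorem tendsto_choose_add_div_choose {e : ℕ} (he : 0 < e) (b c : ℕ) :
    Tendsto (fun m : ℕ => (((e + 1) * m + (b + c)).choose (m + b) : ℝ) / ((e + 1) * m).choose m)
      atTop (𝓝 ((e + 1) ^ b * ((e + 1) / e) ^ c)) := by
  induction b with
  | zero => simpa using tendsto_choose_div_choose_add he c
  | succ b ih =>
    have hlim : ((e : ℝ) + 1) ^ (b + 1) * ((e + 1) / e) ^ c =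
        (e + 1) ^ b * ((e + 1) / e) ^ c * ((e + 1) / 1) := by ring
    rw [hlim]
    refine (ih.mul (tendsto_add_mul_div_add_mul_atTop_nhds (b + c + 1 : ℝ) (b + 1) (e + 1)
      one_ne_zero)).congr fun m => ?_
    have h := Nat.add_one_mul_choose_eq ((e + 1) * m + (b + c)) (m + b)
    replace h := congrArg (Nat.cast : ℕ → ℝ) h
    push_cast at h
    have hpos : (b + 1 + 1 * m : ℝ) ≠ 0 := by positivity
    symm
    rw [div_mul_div_comm, ← mul_div_mul_right _ _ hpos, ← add_assoc m b,
      show (e + 1) * m + (b + 1 + c) = (e + 1) * m + (b + c) + 1 by ring]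
    congr 1
    linear_combination -h

theorem tendsto_choose_div_choose (k : ℕ) :
    Tendsto (fun m : ℕ => ((3 * m + k).choose m : ℝ) / (3 * (m + k + 1) + 1).choose (m + k + 1))
      atTop (𝓝 (2 ^ (k + 3) / 3 ^ (2 * k + 4))) := by
  have h := (tendsto_choose_add_div_choose two_pos 0 k).div
    (tendsto_choose_add_div_choose two_pos (k + 1) (2 * k + 3)) (by positivity)
  convert h using 2 with m
  · have hne : (((2 + 1) * m).choose m : ℝ) ≠ 0 :=
      Nat.cast_ne_zero.2 (Nat.choose_pos (by omega)).ne'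
    rw [Pi.div_apply, div_div_div_cancel_right₀ hne]
    ring_nf
  · simp only [div_pow]
    field_simp
    ring

/-! ### The limit laws -/

theorem raney_three_one_mul (m k : ℕ) :
    (raney 3 1 (m + k + 1) * (3 * k + 4 + 3 * m) : ℝ) =
      (3 * (m + k + 1) + 1).choose (m + k + 1) := by
  have h := raney_mul_real three_pos 1 (m + k + 1)
  push_cast at h
  linear_combination h

theorem tendsto_raney_div_raney (k : ℕ) :
    Tendsto (fun m : ℕ => (raney 3 k m : ℝ) / raney 3 1 (m + k + 1)) atTop
      (𝓝 (k * (2 ^ (k + 3) / 3 ^ (2 * k + 4)))) := by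
  have h := ((tendsto_choose_div_choose k).mul
    (tendsto_add_mul_div_add_mul_atTop_nhds (3 * k + 4 : ℝ) k 3 (three_ne_zero' ℝ))).const_mul
    (k : ℝ)
  rw [div_self three_ne_zero, mul_one] at h
  refine h.congr' ?_
  filter_upwards [eventually_gt_atTop 0] with m hm
  have : (0 : ℝ) < m := Nat.cast_pos.2 hm
  have hk : (k + 3 * m : ℝ) ≠ 0 := by positivity
  have : (3 * k + 4 + 3 * m : ℝ) ≠ 0 := by positivity
  have hpos : (raney 3 1 (m + k + 1) : ℝ) ≠ 0 := by
    exact_mod_cast (raney_pos three_pos one_pos (m + k + 1)).ne'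
  have hr := raney_mul_real three_pos k m
  push_cast at hr
  rw [← raney_three_one_mul]
  field_simp
  linear_combination -hr

theorem tendsto_choose_div_raney (k : ℕ) :
    Tendsto (fun m : ℕ => ((3 * m + k).choose m : ℝ) / (raney 3 1 (m + k + 1) * (m + k + 1)))
      atTop (𝓝 (3 * (2 ^ (k + 3) / 3 ^ (2 * k + 4)))) := by
  have h := (tendsto_choose_div_choose k).mul
    (tendsto_add_mul_div_add_mul_atTop_nhds (3 * k + 4 : ℝ) (k + 1) 3 (d := 1) one_ne_zero)
  rw [div_one, mul_comm _ (3 : ℝ)] at h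
  refine h.congr fun m => ?_
  have hpos : (raney 3 1 (m + k + 1) : ℝ) ≠ 0 := by
    exact_mod_cast (raney_pos three_pos one_pos (m + k + 1)).ne'
  have : (k + 1 + 1 * m : ℝ) ≠ 0 := by positivity
  have : (3 * k + 4 + 3 * m : ℝ) ≠ 0 := by positivity
  rw [← raney_three_one_mul]
  field_simp
  ring

theorem raney_two_three_mul (k : ℕ) :
    (raney 2 3 k : ℝ) * (k + 3) = 3 * (2 * k + 2).choose k := by
  have hr := raney_mul two_pos 3 k
  have hc := Nat.choose_mul_succ_eq (2 * k + 2) k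
  rw [show 2 * k + 2 + 1 - k = k + 3 by omega] at hc
  have h : raney 2 3 k * (k + 3) = 3 * (2 * k + 2).choose k := by
    refine mul_left_cancel₀ (show 2 * k + 3 ≠ 0 by omega) ?_
    linear_combination (k + 3) * hr - 3 * hc
  exact_mod_cast h

theorem hasSum_raney_two_three :
    HasSum (fun k => (raney 2 3 k : ℝ) * (2 / 9) ^ k) (27 / 8) := by
  convert hasSum_raney_two (x := 2 / 9) (a := 3 / 2) (by norm_num) (by norm_num) (by norm_num) 3
  norm_num

theorem hasSum_mul_raney_two_three :
    HasSum (fun k : ℕ => (k : ℝ) * raney 2 3 k * (2 / 9) ^ k) (81 / 8) := by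
  have h := ((hasSum_choose_two_mul_add (x := 2 / 9) (a := 3 / 2) (by norm_num) (by norm_num)
    (by norm_num) 3).sub hasSum_raney_two_three).mul_left (3 / 2)
  rw [show (3 / 2 * (3 / 2 / (2 - 3 / 2) * (3 / 2) ^ 3 - 27 / 8) : ℝ) = 81 / 8 by norm_num] at h
  refine h.congr_fun fun k => ?_
  have hr := raney_mul_real two_pos 3 k
  push_cast at hr
  linear_combination (2 / 9) ^ k / 2 * hr

/-- The limit law of the degree of the first inserted vertex, shifted by `3`. -/
noncomputable def rootLimit (k : ℕ) : ℝ :=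
  (k : ℝ) / (k + 3) * ((2 * k + 2).choose k : ℝ) * (2 ^ (k + 3) / 3 ^ (2 * k + 3))

/-- The limit law of the degree of a uniform internal vertex, shifted by `3`. -/
noncomputable def internalLimit (k : ℕ) : ℝ :=
  1 / ((k : ℝ) + 3) * ((2 * k + 2).choose k : ℝ) * (2 ^ (k + 3) / 3 ^ (2 * k + 2))

theorem internalLimit_eq (k : ℕ) :
    internalLimit k = raney 2 3 k * (3 * (2 ^ (k + 3) / 3 ^ (2 * k + 4))) := by
  have h := raney_two_three_mul k
  rw [internalLimit]
  field_simp
  linear_combination (-27) * 3 ^ (2 * k) * h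

theorem rootLimit_eq (k : ℕ) :
    rootLimit k = raney 2 3 k * (k * (2 ^ (k + 3) / 3 ^ (2 * k + 4))) := by
  have h := raney_two_three_mul k
  rw [rootLimit]
  field_simp
  linear_combination (-27) * k * 3 ^ (2 * k) * h

theorem two_pow_div_three_pow (k : ℕ) :
    (2 ^ (k + 3) / 3 ^ (2 * k + 4) : ℝ) = 8 / 81 * (2 / 9) ^ k := by
  rw [div_pow, show (9 : ℝ) = 3 ^ 2 by norm_num, ← pow_mul]
  ring

theorem hasSum_internalLimit : HasSum internalLimit 1 := by
  have h := hasSum_raney_two_three.mul_left (8 / 27)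
  rw [show (8 / 27 * (27 / 8) : ℝ) = 1 by norm_num] at h
  refine h.congr_fun fun k => ?_
  rw [internalLimit_eq, two_pow_div_three_pow]
  ring

theorem hasSum_rootLimit : HasSum rootLimit 1 := by
  have h := hasSum_mul_raney_two_three.mul_left (8 / 81)
  rw [show (8 / 81 * (81 / 8) : ℝ) = 1 by norm_num] at h
  refine h.congr_fun fun k => ?_
  rw [rootLimit_eq, two_pow_div_three_pow]
  ring

namespace StackTriangulation

theorem tendsto_degreeLaw_apply {u : ∀ (n : ℕ) (t : StackTriangulation (n + 2)), t.rep.Vertex}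
    (hu : ∀ (n : ℕ) (t : StackTriangulation (n + 2)), t.rep.IsFirstInserted (u n t)) (k : ℕ) :
    Tendsto (fun n => (degreeLaw n (u n) (k + 3)).toReal) atTop (𝓝 (rootLimit k)) := by
  rw [rootLimit_eq, ← tendsto_add_atTop_iff_nat k]
  refine ((tendsto_raney_div_raney k).const_mul (raney 2 3 k : ℝ)).congr fun m => ?_
  rw [degreeLaw_apply m k (hu _), mul_div_assoc]

theorem tendsto_internalDegreeLaw_apply (k : ℕ) :
    Tendsto (fun n => (internalDegreeLaw n (k + 3)).toReal) atTop (𝓝 (internalLimit k)) := by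
  rw [internalLimit_eq, ← tendsto_add_atTop_iff_nat k]
  refine ((tendsto_choose_div_raney k).const_mul (raney 2 3 k : ℝ)).congr fun m => ?_
  rw [internalDegreeLaw_apply, mul_div_assoc]

end StackTriangulation

theorem proposition7 :
    (∃ X : PMF ℕ,
      (∀ k : ℕ, (X (k + 3)).toReal =
        (k : ℝ) / (k + 3) * ((2 * k + 2).choose k : ℝ) * (2 ^ (k + 3) / 3 ^ (2 * k + 3))) ∧
      ∀ u : ∀ (n : ℕ) (t : StackTriangulation (n + 2)), t.rep.Vertex,
        (∀ (n : ℕ) (t : StackTriangulation (n + 2)), t.rep.IsFirstInserted (u n t)) →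
        Tendsto (fun n => (StackTriangulation.degreeLaw n (u n)).law) atTop (𝓝 X.law)) ∧
    (∃ Y : PMF ℕ,
      (∀ k : ℕ, (Y (k + 3)).toReal =
        1 / ((k : ℝ) + 3) * ((2 * k + 2).choose k : ℝ) * (2 ^ (k + 3) / 3 ^ (2 * k + 2))) ∧
      Tendsto (fun n => (StackTriangulation.internalDegreeLaw n).law) atTop (𝓝 Y.law)) := by
  constructor
  · obtain ⟨X, hX, hlim⟩ := exists_pmf_tendsto_law
      (fun k => by rw [rootLimit]; positivity) hasSum_rootLimit 3
    exact ⟨X, hX, fun u hu => hlim _ (StackTriangulation.tendsto_degreeLaw_apply hu)⟩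
  · obtain ⟨Y, hY, hlim⟩ := exists_pmf_tendsto_law
      (fun k => by rw [internalLimit]; positivity) hasSum_internalLimit 3
    exact ⟨Y, hY, hlim _ StackTriangulation.tendsto_internalDegreeLaw_apply⟩
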